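/- Let $n\ge 0$, $\mathbf O=\mathbb C[\![t]\!]\subset\mathbf F=\mathbb C(\!(t)\!)$, let $V=\mathbb C^{2n}$ with basis $e_1,\dots,e_{2n}$ and symplectic form $\langle e_i,e_{2n+1-j}\rangle=\delta_{ij}$ ($1\le i,j\le n$; $\langle e_i,e_j\rangle=0$ for $i,j\le n$ and for $i,j>n$), extended $\mathbf F$-bilinearly to $V_{\mathbf F}=V\otimes\mathbf F$; put $V_{\mathbf O}=V\otimes\mathbf O$, $G=\mathrm{Sp}(V)$, $\mathfrak g=\mathfrak{sp}(V)$. *Symplectic side.* Points of $\mathrm{Gr}_G$ are self-dual $\mathbf O$-lattices $L=L^\perp\subset V_{\mathbf F}$, with stabilizers $\mathfrak p_L=\{y\in\mathfrak g_{\mathbf F}: yL\subset L\}$. Points of $V_{\mathbf F}\times T^*\mathrm{Gr}_G$ are triples $(v,L,x)$ with $v\in V_{\mathbf F}$ and $x$ in the nilpotent radical $t\mathfrak p_L$ of $\mathfrak p_L$, viewed as the covector $\Xi\mapsto\mathrm{Res}\,\mathrm{tr}(x\Xi)\,\frac{dt}{t}$ on $T_L\mathrm{Gr}_G=\mathfrak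 g_{\mathbf F}/\mathfrak p_L$. The moment map of the $G_{\mathbf O}$-action, $\boldsymbol\mu\colon V_{\mathbf F}\times T^*\mathrm{Gr}_G\to\mathfrak g_{\mathbf O}^*$, is $$\langle\boldsymbol\mu(v,L,x),X\rangle=\mathrm{Res}\,\langle v,Xv\rangle\,dt+\mathrm{Res}\,\mathrm{tr}(xX)\,\tfrac{dt}{t}\qquad(X\in\mathfrak g_{\mathbf O}).$$ $V_{\mathbf F}\times T^*\mathrm{Gr}_G$ is the union over $N$ of the closed subschemes $\{v\in t^{-N}V_{\mathbf O},\ t^NV_{\mathbf O}\subset L\subset t^{-N}V_{\mathbf O}\}$ (with the reduced structure), and it carries the ind-Zariski topology. An irreducible component of the ind-scheme $\boldsymbol\mu^{-1}(0)$ is a maximal element among the irreducible closed subschemes of $\boldsymbol\mu^{-1}(0)$, that is, among the irreducible closed subsets contained in one of these closed subschemes. *Linear side.* Points of $T^*V_{\mathbf F}\times T^*\mathrm{Gr}_{\mathrm{GL}(2n)}$ are quadruples $(v,w,L,x)$ with $v,w\in V_{\mathbf F}$, $L\subset V_{\mathbf F}$ any $\mathbf O$-lattice and $x\in t\,\mathrm{End}_{\mathbf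 O}(L)$, viewed as the covector $(\xi,\Xi)\mapsto\mathrm{Res}\langle w,\xi\rangle\,dt+\mathrm{Res}\,\mathrm{tr}(x\Xi)\frac{dt}{t}$ at the point $(v,L)\in V_{\mathbf F}\times\mathrm{Gr}_{\mathrm{GL}(2n)}$. The involution $\sigma(v,w,L,x)=(w,v,L^\perp,-x^*)$, with $x^*$ the adjoint of $x$ for $\langle\,,\rangle$, has fixed point set $\{(v,v,L,x)\}=V_{\mathbf F}\times T^*\mathrm{Gr}_G$. *Components.* Given partitions $\theta=(\theta_1\ge\dots\ge\theta_n\ge0)$ and $\zeta=(\zeta_1\ge\dots\ge\zeta_n\ge0)$ put $\lambda=(\theta_1,\dots,\theta_n,-\theta_n,\dots,-\theta_1)$, $\nu=(\zeta_1,\dots,\zeta_n,-\zeta_n,\dots,-\zeta_1)$, and let $\mathbb O_{(\lambda,\nu)}\subset V_{\mathbf F}\times\mathrm{Gr}_{\mathrm{GL}(2n)}$ be the $\mathrm{GL}(2n,\mathbf O)$-orbit of $\bigl(\sum_i t^{-\lambda_i}e_i,\ \bigoplus_i\mathbf O\,t^{-\lambda_i-\nu_i}e_i\bigr)$. Let $\Lambda^{(\theta,\zeta)}$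 be the closure in $V_{\mathbf F}\times T^*\mathrm{Gr}_G$ of the set of $\sigma$-fixed points of the conormal bundle to $\mathbb O_{(\lambda,\nu)}$. **Proposition.** Every irreducible component of $\boldsymbol\mu^{-1}(0)$ is of the form $\Lambda^{(\theta,\zeta)}$ for some pair $(\theta,\zeta)$ of partitions of length $n$. -/

import Mathlib

/-!
Conventions: `𝐎 = ℂ⟦t⟧`, `𝐅 = ℂ((t))`, and the basis of `V` is indexed by `Fin n ⊕ Fin n`, where
`inl i` is the basis vector `e_{i+1}` and `inr i` is its partner `e_{2n-i}`, so that
`⟨e_{inl i}, e_{inr i}⟩ = 1`.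
-/

noncomputable section

namespace MirabolicSp

/-! ### The Tate space `V_𝐅`, its form, lattices -/

/-- The ring of formal power series `ℂ⟦t⟧`. -/
abbrev O : Type := PowerSeries ℂ

/-- The field of formal Laurent series `ℂ((t))`. -/
abbrev F : Type := LaurentSeries ℂ

/-- The index set of the basis of the `2n`-dimensional symplectic space `V`. -/
abbrev Idx (n : ℕ) : Type := Fin n ⊕ Fin n

/-- `V_𝐅 = V ⊗ ℂ((t))`. -/
abbrev VF (n : ℕ) : Type := Idx n → F

/-- `𝔤𝔩(2n, 𝐅)`. -/
abbrev MatF (n : ℕ) : Type := Matrix (Idx n) (Idx n) F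

/-- `𝔤𝔩(2n, 𝐎)`. -/
abbrev MatO (n : ℕ) : Type := Matrix (Idx n) (Idx n) O

/-- The uniformizer `t`. -/
def t : O := PowerSeries.X

/-- An integral matrix regarded as a matrix over `ℂ((t))`. -/
def toF {n : ℕ} (X : MatO n) : MatF n := X.map (algebraMap O F)

/-- The `𝐅`-valued symplectic form `⟨u, v⟩ = ∑ i, (u (inl i) * v (inr i) - u (inr i) * v (inl i))`
on `V_𝐅`. -/
def form (n : ℕ) : LinearMap.BilinForm F (VF n) := Matrix.toBilin' (-(Matrix.J (Fin n) F))

/-- The standard lattice `V_𝐎 = V ⊗ ℂ⟦t⟧`. -/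
def stdLattice (n : ℕ) : Submodule O (VF n) :=
  LinearMap.range ((Algebra.linearMap O F).compLeft (Idx n))

/-- The `𝐎`-submodule `g V_𝐎` of `V_𝐅`. -/
def lat {n : ℕ} (g : MatF n) : Submodule O (VF n) :=
  (stdLattice n).map (g.mulVecLin.restrictScalars O)

/-- The dual lattice `L^⊥ = {u | ⟨u, w⟩ ∈ 𝐎 for all w ∈ L}`. -/
def dual {n : ℕ} (L : Submodule O (VF n)) : Submodule O (VF n) :=
  (form n).dualSubmodule L

/-- `x L ⊆ t L`. For a lattice `L`, this says that `x` lies in the nilpotent radical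
`t ⬝ End_𝐎(L)` of the parahoric subalgebra `End_𝐎(L)` of `𝔤𝔩(2n, 𝐅)`. -/
def MapsIntoT {n : ℕ} (x : MatF n) (L : Submodule O (VF n)) : Prop :=
  ∀ u ∈ L, ∃ w ∈ L, x.mulVec u = t • w

/-- The pairing of a covector `(w, x)` with a tangent vector `(ξ, Ξ)`:
`Res ⟨w, ξ⟩ dt + Res tr (x Ξ) dt/t`. -/
def pair {n : ℕ} (w : VF n) (x : MatF n) (ξ : VF n) (Ξ : MatF n) : ℂ :=
  (form n w ξ).coeff (-1) + ((x * Ξ).trace).coeff 0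

/-! ### The symplectic side: `V_𝐅 × T^*Gr_{Sp(2n)}` -/

/-- The points of `V_𝐅 × T^*Gr_G`, `G = Sp(2n)`. A point of `Gr_G` is a self-dual lattice `L`
(equivalently, its stabilizer `𝔭_L = {x ∈ 𝔤_𝐅 | x L ⊆ L}`, a parahoric subalgebra conjugate to
`𝔤_𝐎`), and a covector at `L` is an element `x` of the nilpotent radical `t 𝔭_L` of `𝔭_L`, viewed
as a functional on `T_L Gr_G = 𝔤_𝐅 / 𝔭_L` by `Ξ ↦ Res tr (x Ξ) dt/t`. -/
structure SpCot (n : ℕ) where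
  v : VF n
  L : Submodule O (VF n)
  x : MatF n
  isLattice : L.IsLattice F
  selfDual : dual L = L
  mem_sp : x ∈ LieAlgebra.Symplectic.sp (Fin n) F
  nil : MapsIntoT x L

/-- The moment map `μ : V_𝐅 × T^*Gr_G → 𝔤_𝐎^*` of the `G_𝐎`-action,
`⟨μ(v, L, x), X⟩ = Res ⟨v, X v⟩ dt + Res tr (x X) dt/t` for `X ∈ 𝔤_𝐎`. In terms of the
identification `𝔤_𝐎^* = 𝔤_𝐅 / t 𝔤_𝐎` by the form `Res tr (x X) dt/t`, it is `(v, L, x) ↦ S²v + x`,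
where `Sym² V_𝐅 ≃ 𝔤_𝐅` sends `S²v` to `t v ⊗ ⟨v, -⟩`. -/
def moment {n : ℕ} (p : SpCot n) (X : LieAlgebra.Symplectic.sp (Fin n) O) : ℂ :=
  pair p.v p.x ((toF X.1).mulVec p.v) (toF X.1)

/-- The zero fiber `μ⁻¹(0)`. -/
def zeroFiber (n : ℕ) : Set (SpCot n) := {p | ∀ X, moment p X = 0}

/-! ### The Zariski topology -/

/-- The Zariski topology on the `ℂ`-points of the (possibly infinite dimensional) affine space
`Spec ℂ[x_a, a ∈ α]`. -/
@[reducible] def zariski (α : Type) : TopologicalSpace (α → ℂ) :=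
  TopologicalSpace.generateFrom
    (Set.range fun p : MvPolynomial α ℂ => {c : α → ℂ | MvPolynomial.eval c p ≠ 0})

/-- The vectors of Laurent series with poles of order at most `N`. -/
def bounded (κ : Type) (N : ℕ) : Set (κ → F) := {f | ∀ i, ∀ m : ℤ, m < -N → (f i).coeff m = 0}

/-- The ind-Zariski topology on `𝐅^κ = colim_N (t^{-N} 𝐎)^κ`: a set is closed iff for each `N` its
intersection with `(t^{-N} 𝐎)^κ` is cut out by polynomials in the coefficients of the series. -/
@[reducible] def indZariski (κ : Type) : TopologicalSpace (κ → F) :=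
  ⨆ N : ℕ, TopologicalSpace.coinduced (Subtype.val : bounded κ N → κ → F)
    (TopologicalSpace.induced (fun f (a : κ × ℤ) => (f.1 a.1).coeff a.2) (zariski (κ × ℤ)))

/-- Points of `V_𝐅 × T^*Gr_G` with a choice of `g ∈ G_𝐅` such that `L = g V_𝐎`; this is the
`G_𝐎`-torsor `V_𝐅 × G_𝐅 × t𝔤_𝐎` over `V_𝐅 × T^*Gr_G`, where `Gr_G = G_𝐅 / G_𝐎`. -/
abbrev Framed (n : ℕ) : Type :=
  {a : SpCot n × Matrix.symplecticGroup (Fin n) F // a.1.L = lat (a.2 : MatF n)}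

/-- The coordinates `(v, g, x)` on the space of framed points. -/
def Framed.coords {n : ℕ} (a : Framed n) : Idx n ⊕ (Idx n × Idx n) ⊕ (Idx n × Idx n) → F :=
  Sum.elim a.1.1.v (Sum.elim (fun ij => (a.1.2 : MatF n) ij.1 ij.2) (fun ij => a.1.1.x ij.1 ij.2))

/-- The Zariski topology on the ind-scheme `V_𝐅 × T^*Gr_G`: the quotient topology from the space of
framed points, which is a subspace of an ind-affine space. -/
instance (n : ℕ) : TopologicalSpace (SpCot n) :=
  TopologicalSpace.coinduced (fun a : Framed n => a.1.1)
    (TopologicalSpace.induced Framed.coords (indZariski _))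

/-- `Z` is contained in one of the schemes
`{(v, L, x) | v ∈ t^{-N} V_𝐎, t^N V_𝐎 ⊆ L ⊆ t^{-N} V_𝐎}` whose union over `N` is the ind-scheme
`V_𝐅 × T^*Gr_G` (for a self-dual `L` the inclusion `t^N V_𝐎 ⊆ L` is automatic). -/
def IsBounded {n : ℕ} (Z : Set (SpCot n)) : Prop :=
  ∃ N : ℕ, ∀ p ∈ Z, p.v ∈ bounded (Idx n) N ∧ (p.L : Set (VF n)) ⊆ bounded (Idx n) N

/-- The irreducible components of a closed subset `X` of the ind-scheme `V_𝐅 × T^*Gr_G`, i.e. the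
maximal elements among the irreducible closed (reduced) subschemes contained in `X`. -/
def IsIrreducibleComponent {n : ℕ} (X Z : Set (SpCot n)) : Prop :=
  Maximal (fun Y => Y ⊆ X ∧ IsClosed Y ∧ IsIrreducible Y ∧ IsBounded Y) Z

/-! ### The general linear side: `T^*V_𝐅 × T^*Gr_{GL(2n)}` -/

/-- Quadruples `(v, w, L, x)`. -/
@[ext]
structure GLPoint (n : ℕ) where
  v : VF n
  w : VF n
  L : Submodule O (VF n)
  x : MatF n

/-- The points of `T^*V_𝐅 × T^*Gr_{GL(2n)} = V_𝐅 × V_𝐅 × T^*Gr_{GL(2n)}`: here `L` is any lattice,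
`w` is viewed as the functional `ξ ↦ Res ⟨w, ξ⟩ dt` on `V_𝐅`, and `x ∈ t End_𝐎(L)` is viewed as
the functional `Ξ ↦ Res tr (x Ξ) dt/t` on `T_L Gr_{GL(2n)} = 𝔤𝔩(2n, 𝐅) / End_𝐎(L)`. -/
def glCot (n : ℕ) : Set (GLPoint n) := {q | q.L.IsLattice F ∧ MapsIntoT q.x q.L}

/-- The involution `σ`. It permutes the two factors `V_𝐅`, it sends a lattice `L` to `L^⊥`, and on
`𝔤𝔩(2n, 𝐅)` it is `x ↦ -x^*` with `x^* = J⁻¹ xᵀ J` the adjoint of `x` with respect to the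
symplectic form. -/
def sigma {n : ℕ} (q : GLPoint n) : GLPoint n where
  v := q.w
  w := q.v
  L := dual q.L
  x := -((Matrix.J (Fin n) F)⁻¹ * q.x.transpose * Matrix.J (Fin n) F)

/-- The embedding of `V_𝐅 × T^*Gr_{Sp(2n)}` into `T^*V_𝐅 × T^*Gr_{GL(2n)}`; its image is the set of
`σ`-fixed points, see `sigma_fixed_iff`. -/
def SpCot.toGL {n : ℕ} (p : SpCot n) : GLPoint n where
  v := p.v
  w := p.v
  L := p.L
  x := p.x

theorem neg_adjoint_eq_self_iff (n : ℕ) (K : Type) [Field K]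
    (x : Matrix (Idx n) (Idx n) K) :
    -((Matrix.J (Fin n) K)⁻¹ * x.transpose * Matrix.J (Fin n) K) = x ↔
      x ∈ LieAlgebra.Symplectic.sp (Fin n) K := by
  have hJ : Matrix.J (Fin n) K * Matrix.J (Fin n) K = -1 := Matrix.J_squared (Fin n) K
  have hinv : (Matrix.J (Fin n) K)⁻¹ = -Matrix.J (Fin n) K :=
    Matrix.inv_eq_right_inv (by rw [mul_neg, hJ, neg_neg])
  have hmem : x ∈ LieAlgebra.Symplectic.sp (Fin n) K ↔
      x.transpose * Matrix.J (Fin n) K = Matrix.J (Fin n) K * (-x) :=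
    (mem_skewAdjointMatricesLieSubalgebra (Matrix.J (Fin n) K) x).trans
      (mem_skewAdjointMatricesSubmodule' _ _)
  rw [hmem, hinv]
  constructor
  · intro h
    have h2 : Matrix.J (Fin n) K * x = Matrix.J (Fin n) K *
      (Matrix.J (Fin n) K * (x.transpose * Matrix.J (Fin n) K)) := by
      conv_lhs => rw [← h]
      simp only [neg_mul, neg_neg, Matrix.mul_assoc]
    rw [mul_neg, h2, ← Matrix.mul_assoc, hJ]
    simp
  · intro h
    rw [Matrix.mul_assoc, h, ← Matrix.mul_assoc, neg_mul, hJ]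
    simp

theorem mem_sp_iff {n : ℕ} (x : MatF n) :
    -((Matrix.J (Fin n) F)⁻¹ * x.transpose * Matrix.J (Fin n) F) = x ↔
      x ∈ LieAlgebra.Symplectic.sp (Fin n) F :=
  neg_adjoint_eq_self_iff n F x

theorem sigma_fixed_iff {n : ℕ} (q : GLPoint n) :
    (q ∈ glCot n ∧ sigma q = q) ↔ ∃ p : SpCot n, p.toGL = q := by
  constructor
  · rintro ⟨⟨h1, h2⟩, h3⟩
    have hw : q.v = q.w := congrArg GLPoint.w h3
    have hL : dual q.L = q.L := congrArg GLPoint.L h3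
    have hx := congrArg GLPoint.x h3
    exact ⟨⟨q.v, q.L, q.x, h1, hL, (mem_sp_iff _).1 hx, h2⟩, by
      ext1 <;> simp [SpCot.toGL, hw]⟩
  · rintro ⟨p, rfl⟩
    refine ⟨⟨p.isLattice, p.nil⟩, ?_⟩
    have := (mem_sp_iff _).2 p.mem_sp
    ext1
    · rfl
    · rfl
    · exact p.selfDual
    · exact this

/-- The `GL(2n, 𝐎)`-orbit of `(v, L)` in `V_𝐅 × Gr_{GL(2n)}`. -/
def orbit {n : ℕ} (v : VF n) (L : Submodule O (VF n)) : Set (VF n × Submodule O (VF n)) :=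
  {a | ∃ k : (MatO n)ˣ, a.1 = (toF k.1).mulVec v ∧
    a.2 = L.map ((toF k.1).mulVecLin.restrictScalars O)}

/-- The orbit `𝕆_{(λ, ν)}` of `v = ∑ i, t^{-λ_i} e_i`, `L = ⨁ i, 𝐎 t^{-λ_i-ν_i} e_i`. -/
def bisignatureOrbit {n : ℕ} (lam nu : Idx n → ℤ) : Set (VF n × Submodule O (VF n)) :=
  orbit (fun i => HahnSeries.single (-lam i) 1)
    (lat (Matrix.diagonal fun i => HahnSeries.single (-lam i - nu i) 1))

/-- The conormal bundle to a `GL(2n, 𝐎)`-orbit `S` in `V_𝐅 × Gr_{GL(2n)}`: the covectors at the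
points `(v, L)` of `S` that annihilate the tangent space `{(X v, X mod End_𝐎(L)) | X ∈ 𝔤𝔩(2n, 𝐎)}`
of the orbit. -/
def conormal {n : ℕ} (S : Set (VF n × Submodule O (VF n))) : Set (GLPoint n) :=
  {q | q ∈ glCot n ∧ (q.v, q.L) ∈ S ∧
    ∀ X : MatO n, pair q.w q.x ((toF X).mulVec q.v) (toF X) = 0}

/-! ### The components -/

/-- Partitions of length `n`: `θ_1 ≥ … ≥ θ_n ≥ 0`. -/
abbrev Partition (n : ℕ) : Type := {θ : Fin n → ℕ // Antitone θ}

/-- The self-dual signature `(θ_1 ≥ … ≥ θ_n ≥ -θ_n ≥ … ≥ -θ_1)`; its entry at the vector `inr i`,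
the partner of `inl i`, is the opposite of its entry at `inl i`. -/
def Partition.selfDual {n : ℕ} (θ : Partition n) : Idx n → ℤ :=
  Sum.elim (fun i => (θ.1 i : ℤ)) (fun i => -(θ.1 i : ℤ))

/-- `Λ^{(θ, ζ)}`: the closure in `V_𝐅 × T^*Gr_{Sp(2n)}` of the `σ`-fixed points of the conormal
bundle to the `GL(2n, 𝐎)`-orbit `𝕆_{(λ, ν)}` of the self-dual bisignature given by `(θ, ζ)`. -/
def Lam {n : ℕ} (θ ζ : Partition n) : Set (SpCot n) :=
  closure {p | p.toGL ∈ conormal (bisignatureOrbit θ.selfDual ζ.selfDual) ∧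
    sigma p.toGL = p.toGL}

end MirabolicSp

end

noncomputable section

namespace MirabolicSp

open Matrix
open scoped Topology

/-! ### Orders of Laurent series -/

/-- `t^m 𝐎`, the Laurent series of order at least `m`. -/
def ord (m : ℤ) : Submodule O F where
  carrier := {f | ∀ j < m, f.coeff j = 0}
  zero_mem' := fun _ _ => rfl
  add_mem' := fun hf hg j hj => by simp [hf j hj, hg j hj]
  smul_mem' := fun c f hf j hj => by
    rw [Algebra.smul_def, HahnSeries.coeff_mul]
    refine Finset.sum_eq_zero fun ij hij => ?_
    rw [Finset.mem_antidiagonal] at hij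
    by_cases h : ij.1 < 0
    · rw [show (algebraMap O F c).coeff ij.1 = 0 from (PowerSeries.coeff_coe _ _).trans (if_pos h),
        zero_mul]
    · rw [hf _ (by omega), mul_zero]

theorem ord_anti {m m' : ℤ} (h : m ≤ m') {f : F} (hf : f ∈ ord m') : f ∈ ord m :=
  fun j hj => hf j (hj.trans_le h)

theorem mul_mem_ord {a b : ℤ} {f g : F} (hf : f ∈ ord a) (hg : g ∈ ord b) :
    f * g ∈ ord (a + b) := by
  intro j hj
  rw [HahnSeries.coeff_mul]
  refine Finset.sum_eq_zero fun ij hij => ?_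
  rw [Finset.mem_antidiagonal] at hij
  by_cases h : ij.1 < a
  · rw [hf _ h, zero_mul]
  · rw [hg _ (by omega), mul_zero]

theorem exists_mem_ord (f : F) : ∃ m : ℤ, f ∈ ord m := by
  by_cases hf : f = 0
  · exact ⟨0, hf ▸ (ord 0).zero_mem⟩
  · exact ⟨f.order, fun j hj => HahnSeries.coeff_eq_zero_of_lt_order hj⟩

theorem coeff_coe_nat (a : O) (k : ℕ) : (algebraMap O F a).coeff (k : ℤ) = PowerSeries.coeff k a :=
  LaurentSeries.coeff_coe_powerSeries a k

theorem coe_mem_ord (a : O) : algebraMap O F a ∈ ord 0 :=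
  fun _ hj => (PowerSeries.coeff_coe _ _).trans (if_pos hj)

theorem mem_ord_zero_iff {f : F} : f ∈ ord 0 ↔ ∃ a : O, algebraMap O F a = f := by
  refine ⟨fun hf => ⟨PowerSeries.mk fun k => f.coeff k, ?_⟩, ?_⟩
  · ext j
    rcases lt_or_ge j 0 with hj | hj
    · rw [hf j hj, coe_mem_ord _ j hj]
    · lift j to ℕ using hj
      rw [coeff_coe_nat, PowerSeries.coeff_mk]
  · rintro ⟨a, rfl⟩
    exact coe_mem_ord a

/-- The power `t^m`. -/
abbrev tpow (m : ℤ) : F := HahnSeries.single m 1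

theorem tpow_add (a b : ℤ) : tpow (a + b) = tpow a * tpow b := by
  rw [tpow, tpow, tpow, HahnSeries.single_mul_single, mul_one]

theorem tpow_zero : tpow 0 = 1 := rfl

theorem tpow_mem_ord (m : ℤ) : tpow m ∈ ord m :=
  fun _ hj => HahnSeries.coeff_single_of_ne hj.ne

theorem tpow_mul_neg (m : ℤ) : tpow m * tpow (-m) = 1 := by
  rw [← tpow_add, add_neg_cancel, tpow_zero]

theorem tpow_neg_mul (m : ℤ) : tpow (-m) * tpow m = 1 := by
  rw [mul_comm, tpow_mul_neg]

theorem tpow_mul_mem_ord {m a : ℤ} {f : F} : tpow m * f ∈ ord a ↔ f ∈ ord (a - m) := by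
  constructor
  · intro h
    have := mul_mem_ord (tpow_mem_ord (-m)) h
    rwa [← mul_assoc, tpow_neg_mul, one_mul, neg_add_eq_sub] at this
  · intro h
    have := mul_mem_ord (tpow_mem_ord m) h
    rwa [add_sub_cancel] at this

theorem t_smul (f : F) : t • f = tpow 1 * f := by
  rw [Algebra.smul_def]
  congr 1
  exact PowerSeries.coe_X

/-- A Laurent series lies in `t 𝐎` if the constant terms of its integral multiples all vanish. -/
theorem mem_ord_one_of_coeff {f : F} (h : ∀ a : O, (algebraMap O F a * f).coeff 0 = 0) :
    f ∈ ord 1 := by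
  intro j hj
  have h1 := h (PowerSeries.X ^ (-j).toNat)
  have h2 : algebraMap O F (PowerSeries.X ^ (-j).toNat) = tpow (-j) := by
    refine (HahnSeries.ofPowerSeries_X_pow _).trans ?_
    rw [Int.toNat_of_nonneg (by omega)]
  rw [h2] at h1
  have h3 := HahnSeries.coeff_single_mul_add (Γ := ℤ) (r := (1 : ℂ)) (x := f) (a := j) (b := -j)
  rwa [add_neg_cancel, one_mul, h1, eq_comm] at h3

theorem isUnit_of_coeff_ne {a : O} (h : PowerSeries.constantCoeff a ≠ 0) : IsUnit a :=
  PowerSeries.isUnit_iff_constantCoeff.2 (isUnit_iff_ne_zero.2 h)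

/-- A Laurent series with leading term at `t^m` is `t^m` times a unit. -/
theorem exists_unit_of_coeff_ne {f : F} {m : ℤ} (hf : f ∈ ord m) (h : f.coeff m ≠ 0) :
    ∃ a : Oˣ, f = algebraMap O F a * tpow m := by
  have h1 : tpow (-m) * f ∈ ord 0 := tpow_mul_mem_ord.2 (by simpa using hf)
  obtain ⟨a, ha⟩ := mem_ord_zero_iff.1 h1
  have h2 : PowerSeries.constantCoeff a = f.coeff m := by
    have h3 := HahnSeries.coeff_single_mul_add (Γ := ℤ) (r := (1 : ℂ)) (x := f) (a := m) (b := -m)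
    rw [add_neg_cancel, one_mul] at h3
    rw [← h3, ← PowerSeries.coeff_zero_eq_constantCoeff_apply, ← coeff_coe_nat, ha]
    rfl
  obtain ⟨u, rfl⟩ := isUnit_of_coeff_ne (h2 ▸ h)
  refine ⟨u, ?_⟩
  rw [ha, mul_right_comm, tpow_neg_mul, one_mul]

/-! ### Families of Laurent series -/

theorem coeff_mul_of_mem_ord {a b : ℤ} {f g : F} (hf : f ∈ ord a) (hg : g ∈ ord b) (m : ℤ) :
    (f * g).coeff m = ∑ i ∈ Finset.Icc a (m - b), f.coeff i * g.coeff (m - i) := by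
  rw [HahnSeries.coeff_mul]
  symm
  refine Finset.sum_bij_ne_zero (fun i _ _ => (i, m - i)) ?_ ?_ ?_ ?_
  · intro i _ hi
    rw [Finset.mem_antidiagonal]
    exact ⟨left_ne_zero_of_mul hi, right_ne_zero_of_mul hi, by ring⟩
  · intro i _ _ j _ _ hij
    exact congrArg Prod.fst hij
  · rintro ⟨i, j⟩ hij hne
    rw [Finset.mem_antidiagonal] at hij
    obtain ⟨-, -, rfl⟩ := hij
    have h1 : ¬ i < a := fun h => hne (by simp only [hf i h, zero_mul])
    have h2 : ¬ j < b := fun h => hne (by simp only [hg j h, mul_zero])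
    dsimp only at h1 h2 hne ⊢
    refine ⟨i, Finset.mem_Icc.2 ⟨by omega, by omega⟩, ?_, ?_⟩
    · rwa [add_sub_cancel_left]
    · rw [add_sub_cancel_left]
  · intro i _ _
    rfl

/-- Families of Laurent series with uniformly bounded poles, all of whose coefficients lie in a
given ring of functions. -/
def laurentFam {X : Type} (R : Subalgebra ℂ (X → ℂ)) : Subring (X → F) where
  carrier := {f | (∃ m : ℤ, ∀ x, f x ∈ ord m) ∧ ∀ j, (fun x => (f x).coeff j) ∈ R}
  zero_mem' := ⟨⟨0, fun _ => (ord 0).zero_mem⟩, fun _ => R.zero_mem⟩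
  one_mem' := ⟨⟨0, fun _ => tpow_mem_ord 0⟩, fun j => R.algebraMap_mem ((1 : F).coeff j)⟩
  add_mem' := by
    rintro f g ⟨⟨a, ha⟩, hf⟩ ⟨⟨b, hb⟩, hg⟩
    exact ⟨⟨min a b, fun x => (ord _).add_mem (ord_anti (min_le_left _ _) (ha x))
      (ord_anti (min_le_right _ _) (hb x))⟩, fun j => R.add_mem (hf j) (hg j)⟩
  neg_mem' := by
    rintro f ⟨⟨a, ha⟩, hf⟩
    exact ⟨⟨a, fun x => (ord _).neg_mem (ha x)⟩, fun j => R.neg_mem (hf j)⟩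
  mul_mem' := by
    rintro f g ⟨⟨a, ha⟩, hf⟩ ⟨⟨b, hb⟩, hg⟩
    refine ⟨⟨a + b, fun x => mul_mem_ord (ha x) (hb x)⟩, fun j => ?_⟩
    have : (fun x => ((f * g) x).coeff j) = ∑ i ∈ Finset.Icc a (j - b),
        (fun x => (f x).coeff i) * (fun x => (g x).coeff (j - i)) := by
      ext x
      rw [Pi.mul_apply, coeff_mul_of_mem_ord (ha x) (hb x), Finset.sum_apply]
      rfl
    rw [this]
    exact R.sum_mem fun i _ => R.mul_mem (hf i) (hg _)

theorem laurentFam_const {X : Type} (R : Subalgebra ℂ (X → ℂ)) (f : F) :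
    (fun _ => f) ∈ laurentFam R :=
  ⟨(exists_mem_ord f).imp fun _ h _ => h, fun j => R.algebraMap_mem (f.coeff j)⟩

/-- Families of matrices with entries in `laurentFam`. -/
def IsMatFam {X : Type} (R : Subalgebra ℂ (X → ℂ)) {m n : Type} (A : X → Matrix m n F) : Prop :=
  ∀ i j, (fun x => A x i j) ∈ laurentFam R

theorem IsMatFam.mul {X : Type} {R : Subalgebra ℂ (X → ℂ)} {l m n : Type} [Fintype m]
    {A : X → Matrix l m F} {B : X → Matrix m n F} (hA : IsMatFam R A) (hB : IsMatFam R B) :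
    IsMatFam R (fun x => A x * B x) := by
  intro i j
  have : (fun x => (A x * B x) i j) = ∑ k, (fun x => A x i k) * (fun x => B x k j) := by
    ext1 x
    rw [Finset.sum_apply]
    rfl
  rw [this]
  exact sum_mem fun k _ => mul_mem (hA i k) (hB k j)

theorem IsMatFam.mulVec {X : Type} {R : Subalgebra ℂ (X → ℂ)} {m n : Type} [Fintype n]
    {A : X → Matrix m n F} {v : X → n → F} (hA : IsMatFam R A)
    (hv : ∀ i, (fun x => v x i) ∈ laurentFam R) (i : m) :
    (fun x => (A x).mulVec (v x) i) ∈ laurentFam R := by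
  have : (fun x => (A x).mulVec (v x) i) = ∑ k, (fun x => A x i k) * (fun x => v x k) := by
    ext1 x
    rw [Finset.sum_apply]
    rfl
  rw [this]
  exact sum_mem fun k _ => mul_mem (hA i k) (hv k)

theorem IsMatFam.const {X : Type} {R : Subalgebra ℂ (X → ℂ)} {m n : Type} (A : Matrix m n F) :
    IsMatFam R (fun _ => A) := fun _ _ => laurentFam_const _ _

theorem IsMatFam.transpose {X : Type} {R : Subalgebra ℂ (X → ℂ)} {m n : Type}
    {A : X → Matrix m n F} (hA : IsMatFam R A) : IsMatFam R (fun x => (A x).transpose) :=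
  fun i j => hA j i

/-- Polynomial functions on the affine line. -/
def polyFun : Subalgebra ℂ (ℂ → ℂ) where
  carrier := {f | ∃ p : Polynomial ℂ, ∀ s, f s = p.eval s}
  add_mem' := by
    rintro f g ⟨p, hp⟩ ⟨q, hq⟩
    exact ⟨p + q, fun s => by simp [hp, hq]⟩
  mul_mem' := by
    rintro f g ⟨p, hp⟩ ⟨q, hq⟩
    exact ⟨p * q, fun s => by simp [hp, hq]⟩
  algebraMap_mem' := fun c => ⟨Polynomial.C c, fun s => by simp⟩

theorem polyFun_comp {f : ℂ → ℂ} (hf : f ∈ polyFun) (q : Polynomial ℂ) :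
    (fun s => f (q.eval s)) ∈ polyFun := by
  obtain ⟨p, hp⟩ := hf
  exact ⟨p.comp q, fun s => by simp [hp]⟩

theorem laurentFam_polyFun_comp {f : ℂ → F} (hf : f ∈ laurentFam polyFun) (q : Polynomial ℂ) :
    (fun s => f (q.eval s)) ∈ laurentFam polyFun :=
  ⟨hf.1.imp fun _ h _ => h _, fun j => polyFun_comp (hf.2 j) q⟩

/-- Scalar polynomial functions as families of Laurent series. -/
theorem laurentFam_C {f : ℂ → ℂ} (hf : f ∈ polyFun) :
    (fun s => (HahnSeries.C (f s) : F)) ∈ laurentFam polyFun := by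
  refine ⟨⟨0, fun s j hj => HahnSeries.coeff_single_of_ne hj.ne⟩, fun j => ?_⟩
  by_cases h : j = 0
  · subst h
    have : (fun s => (HahnSeries.C (f s) : F).coeff 0) = f := by
      ext s
      exact HahnSeries.coeff_single_same _ _
    rwa [this]
  · have : (fun s => (HahnSeries.C (f s) : F).coeff j) = 0 := by
      ext s
      exact HahnSeries.coeff_single_of_ne h
    rw [this]
    exact polyFun.zero_mem

/-! ### Closed subsets of `V_𝐅 × T^*Gr_G` -/

/-- The index set of the coordinates on framed points. -/
abbrev Crd (n : ℕ) : Type := Idx n ⊕ (Idx n × Idx n) ⊕ (Idx n × Idx n)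

theorem exists_uniform_ord {X κ : Type} [Finite κ] {f : κ → X → F}
    (h : ∀ i, ∃ m : ℤ, ∀ x, f i x ∈ ord m) : ∃ N : ℕ, ∀ i x, f i x ∈ ord (-N) := by
  cases nonempty_fintype κ
  choose m hm using h
  refine ⟨∑ i, (m i).natAbs, fun i x => ord_anti ?_ (hm i x)⟩
  have := Finset.single_le_sum (f := fun i => (m i).natAbs) (fun _ _ => Nat.zero_le _)
    (Finset.mem_univ i)
  omega

/-- The polynomial functions of the coefficients on `(t^{-N} 𝐎)^κ`. -/
def regFun (κ : Type) (N : ℕ) : Subalgebra ℂ (bounded κ N → ℂ) where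
  carrier := {f | ∃ p : MvPolynomial (κ × ℤ) ℂ,
    ∀ x, f x = MvPolynomial.eval (fun a => (x.1 a.1).coeff a.2) p}
  add_mem' := by
    rintro f g ⟨p, hp⟩ ⟨q, hq⟩
    exact ⟨p + q, fun s => by simp [hp, hq]⟩
  mul_mem' := by
    rintro f g ⟨p, hp⟩ ⟨q, hq⟩
    exact ⟨p * q, fun s => by simp [hp, hq]⟩
  algebraMap_mem' := fun c => ⟨MvPolynomial.C c, fun s => by simp⟩

theorem coord_mem_regFam {κ : Type} (N : ℕ) (i : κ) :
    (fun x : bounded κ N => x.1 i) ∈ laurentFam (regFun κ N) :=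
  ⟨⟨-N, fun x => x.2 i⟩, fun j => ⟨MvPolynomial.X (i, j), fun x => by simp⟩⟩

theorem isOpen_spCot_iff {n : ℕ} {U : Set (SpCot n)} :
    IsOpen U ↔ ∃ W : Set (Crd n → F), (∀ N : ℕ, ∃ S : Set (Crd n × ℤ → ℂ),
      IsOpen[zariski (Crd n × ℤ)] S ∧ ∀ f ∈ bounded (Crd n) N,
        (f ∈ W ↔ (fun a : Crd n × ℤ => (f a.1).coeff a.2) ∈ S)) ∧
      ∀ a : Framed n, a.1.1 ∈ U ↔ a.coords ∈ W := by
  have h1 : IsOpen U ↔ IsOpen[TopologicalSpace.induced Framed.coords (indZariski (Crd n))]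
      ((fun a : Framed n => a.1.1) ⁻¹' U) := Iff.rfl
  rw [h1, @isOpen_induced_iff _ _ (indZariski (Crd n))]
  have h2 : ∀ W : Set (Crd n → F), IsOpen[indZariski (Crd n)] W ↔
      ∀ N : ℕ, ∃ S : Set (Crd n × ℤ → ℂ),
      IsOpen[zariski (Crd n × ℤ)] S ∧ ∀ f ∈ bounded (Crd n) N,
        (f ∈ W ↔ (fun a : Crd n × ℤ => (f a.1).coeff a.2) ∈ S) := by
    intro W
    rw [indZariski, isOpen_iSup_iff]
    refine forall_congr' fun N => ?_
    rw [isOpen_coinduced, @isOpen_induced_iff _ _ (zariski (Crd n × ℤ))]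
    refine exists_congr fun S => and_congr_right fun _ => ?_
    rw [Set.ext_iff]
    exact ⟨fun h f hf => (h ⟨f, hf⟩).symm, fun h f => (h f.1 f.2).symm⟩
  refine exists_congr fun W => and_congr (h2 W) ?_
  rw [Set.ext_iff]
  exact forall_congr' fun a => Iff.comm

/-- Conditions which are polynomial in the coordinates of framed points define a closed set. -/
theorem isClosed_of_coeff {n : ℕ} {C : Set (SpCot n)} {ι : Type} (Φ : ι → (Crd n → F) → F)
    (j : ι → ℤ)
    (hΦ : ∀ i, ∀ N : ℕ, (fun x : bounded (Crd n) N => Φ i x.1) ∈ laurentFam (regFun (Crd n) N))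
    (hC : ∀ a : Framed n, a.1.1 ∈ C ↔ ∀ i, (Φ i a.coords).coeff (j i) = 0) : IsClosed C := by
  rw [← isOpen_compl_iff, isOpen_spCot_iff]
  refine ⟨{f | ¬ ∀ i, (Φ i f).coeff (j i) = 0}, fun N => ?_, fun a => not_congr (hC a)⟩
  choose p hp using fun i => (hΦ i N).2 (j i)
  refine ⟨⋃ i, {c | MvPolynomial.eval c (p i) ≠ 0}, ?_, fun f hf => ?_⟩
  · exact @isOpen_iUnion _ _ (zariski (Crd n × ℤ)) _ fun i =>
      TopologicalSpace.isOpen_generateFrom_of_mem ⟨p i, rfl⟩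
  · rw [Set.mem_iUnion, Set.mem_ofPred_eq, not_forall]
    exact exists_congr fun i => by rw [Set.mem_ofPred_eq, ← hp i ⟨f, hf⟩]

/-- A curve with polynomial coefficients lies in a closed subset as soon as infinitely many of its
points do. -/
theorem finite_or_subset_of_isClosed {n : ℕ} {C : Set (SpCot n)} (hC : IsClosed C)
    (φ : ℂ → Framed n) (hφ : ∀ a, (fun s => (φ s).coords a) ∈ laurentFam polyFun) :
    {s | (φ s).1.1 ∈ C}.Finite ∨ ∀ s, (φ s).1.1 ∈ C := by
  rw [← isOpen_compl_iff, isOpen_spCot_iff] at hC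
  obtain ⟨W, hW, hCW⟩ := hC
  obtain ⟨N, hN⟩ := exists_uniform_ord (f := fun a s => (φ s).coords a) fun a => (hφ a).1
  obtain ⟨S, hS, hWS⟩ := hW N
  choose q hq using fun a : Crd n × ℤ => (hφ a.1).2 a.2
  have key : {s | (φ s).1.1 ∈ Cᶜ} =
      {s | (fun a : Crd n × ℤ => (q a).eval s) ∈ S} := by
    ext s
    rw [Set.mem_ofPred_eq, hCW, hWS _ (fun a => hN a s), Set.mem_ofPred_eq,
      ← funext fun a => hq a s]
  have main : ∀ T : Set (Crd n × ℤ → ℂ), IsOpen[zariski (Crd n × ℤ)] T →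
      {s : ℂ | (fun a : Crd n × ℤ => (q a).eval s) ∈ T}ᶜ.Finite ∨
        ∀ s : ℂ, (fun a : Crd n × ℤ => (q a).eval s) ∉ T := by
    intro T hT
    induction hT with
    | basic T hT =>
      obtain ⟨p, rfl⟩ := hT
      have he : ∀ s : ℂ, MvPolynomial.eval (fun a => (q a).eval s) p =
          (MvPolynomial.aeval q p).eval s := by
        intro s
        have : (MvPolynomial.eval fun a => (q a).eval s) =
            (Polynomial.evalRingHom s).comp (MvPolynomial.aeval q).toRingHom := by
          ext <;> simp
        rw [this]
        rfl
      by_cases h0 : MvPolynomial.aeval q p = 0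
      · right
        intro s hs
        exact hs (by rw [he, h0, Polynomial.eval_zero])
      · left
        refine (Polynomial.finite_setOfPred_isRoot h0).subset fun s hs => ?_
        have hs' : MvPolynomial.eval (fun a => (q a).eval s) p = 0 := by
          simpa using hs
        rwa [he] at hs'
    | univ => exact Or.inl (by simp)
    | inter A B _ _ hA hB =>
      rcases hA with hA | hA
      · rcases hB with hB | hB
        · left
          refine (hA.union hB).subset fun s hs => ?_
          by_contra h
          rw [Set.mem_union, not_or, Set.notMem_compl_iff, Set.notMem_compl_iff] at h
          exact hs h
        · exact Or.inr fun s hs => hB s hs.2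
      · exact Or.inr fun s hs => hA s hs.1
    | sUnion 𝒯 _ ih =>
      by_cases h : ∃ A ∈ 𝒯, {s : ℂ | (fun a : Crd n × ℤ => (q a).eval s) ∈ A}ᶜ.Finite
      · obtain ⟨A, hA, hfin⟩ := h
        exact Or.inl (hfin.subset fun s hs hsA => hs ⟨A, hA, hsA⟩)
      · right
        rintro s ⟨A, hA, hs⟩
        rcases ih A hA with h1 | h1
        · exact h ⟨A, hA, h1⟩
        · exact h1 s hs
  rcases main S hS with h | h
  · left
    rw [← key] at h
    convert h using 1
    ext s
    simp
  · right
    intro s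
    by_contra hs
    have : s ∈ {s | (φ s).1.1 ∈ Cᶜ} := hs
    rw [key] at this
    exact h s this

/-- A set is preirreducible if any two of its points are joined by a curve in it with polynomial
coefficients. -/
theorem isPreirreducible_of_curves {n : ℕ} {T : Set (SpCot n)}
    (h : ∀ p ∈ T, ∀ q ∈ T, ∃ φ : ℂ → Framed n,
      (∀ a, (fun s => (φ s).coords a) ∈ laurentFam polyFun) ∧
      (∀ s, (φ s).1.1 ∈ T) ∧ (φ 0).1.1 = p ∧ (φ 1).1.1 = q) : IsPreirreducible T := by
  rintro U V hU hV ⟨p, hpT, hpU⟩ ⟨q, hqT, hqV⟩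
  obtain ⟨φ, hφ, hT, rfl, rfl⟩ := h p hpT q hqT
  have hU' := (finite_or_subset_of_isClosed hU.isClosed_compl φ hφ).resolve_right
    fun h => h 0 hpU
  have hV' := (finite_or_subset_of_isClosed hV.isClosed_compl φ hφ).resolve_right
    fun h => h 1 hqV
  obtain ⟨s, hs⟩ := (hU'.union hV').infinite_compl.nonempty
  rw [Set.mem_compl_iff, Set.mem_union, not_or] at hs
  exact ⟨_, hT s, not_not.1 hs.1, not_not.1 hs.2⟩

/-- A point lies in the closure of a set if it is on a curve with polynomial coefficients almost
all of whose points are in that set. -/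
theorem mem_closure_of_curve {n : ℕ} {S : Set (SpCot n)} (φ : ℂ → Framed n)
    (hφ : ∀ a, (fun s => (φ s).coords a) ∈ laurentFam polyFun)
    (hS : {s | (φ s).1.1 ∉ S}.Finite) (s : ℂ) : (φ s).1.1 ∈ closure S := by
  refine (finite_or_subset_of_isClosed isClosed_closure φ hφ).resolve_left (fun h => ?_) s
  obtain ⟨s, hs⟩ := (h.union hS).infinite_compl.nonempty
  rw [Set.mem_compl_iff, Set.mem_union, not_or] at hs
  exact hs.1 (subset_closure (not_not.1 hs.2))

/-! ### The symplectic form in coordinates -/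

section Ring

variable {n : ℕ} {R : Type} [CommRing R]

/-- The row vector `⟨v, -⟩`. -/
def corow (v : Idx n → R) : Idx n → R :=
  Sum.elim (fun i => -v (Sum.inr i)) (fun i => v (Sum.inl i))

theorem corow_eq (v : Idx n → R) : corow v = v ᵥ* (-J (Fin n) R) := by
  ext k
  rcases k with k | k <;> simp [corow, J, Matrix.vecMul, dotProduct, Matrix.one_apply]

theorem transpose_mul_J {k : Matrix (Idx n) (Idx n) R} (hk : k ∈ symplecticGroup (Fin n) R) :
    kᵀ * J (Fin n) R * k = J (Fin n) R :=
  SymplecticGroup.mem_iff'.1 hk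

theorem corow_mulVec {k : Matrix (Idx n) (Idx n) R} (hk : k ∈ symplecticGroup (Fin n) R)
    (v : Idx n → R) : corow (k *ᵥ v) ᵥ* k = corow v := by
  rw [corow_eq, corow_eq, ← Matrix.vecMul_transpose, Matrix.vecMul_vecMul, Matrix.vecMul_vecMul,
    Matrix.neg_mul, Matrix.mul_neg, ← Matrix.mul_assoc, transpose_mul_J hk]

theorem mem_sp_matrix {x : Matrix (Idx n) (Idx n) R} :
    x ∈ LieAlgebra.Symplectic.sp (Fin n) R ↔ xᵀ * J (Fin n) R = J (Fin n) R * (-x) :=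
  (mem_skewAdjointMatricesLieSubalgebra (J (Fin n) R) x).trans
    (mem_skewAdjointMatricesSubmodule' _ _)

theorem add_J_transpose_J_mem_sp (B : Matrix (Idx n) (Idx n) R) :
    B + J (Fin n) R * Bᵀ * J (Fin n) R ∈ LieAlgebra.Symplectic.sp (Fin n) R := by
  have hJ := J_squared (Fin n) R
  rw [mem_sp_matrix]
  simp only [transpose_add, transpose_mul, J_transpose, transpose_transpose, Matrix.add_mul,
    neg_add, Matrix.mul_add, Matrix.mul_neg, Matrix.neg_mul, neg_neg]
  rw [Matrix.mul_assoc (J (Fin n) R), Matrix.mul_assoc B, hJ, ← Matrix.mul_assoc (J (Fin n) R)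
    (J (Fin n) R * Bᵀ), ← Matrix.mul_assoc (J (Fin n) R) (J (Fin n) R), hJ]
  simp only [Matrix.mul_neg, Matrix.mul_one, Matrix.neg_mul, Matrix.one_mul, neg_neg]
  exact add_comm _ _

theorem trace_mul_add_J_transpose_J {y : Matrix (Idx n) (Idx n) R}
    (hy : y ∈ LieAlgebra.Symplectic.sp (Fin n) R) (B : Matrix (Idx n) (Idx n) R) :
    (y * (B + J (Fin n) R * Bᵀ * J (Fin n) R)).trace = 2 * (y * B).trace := by
  have hJ := J_squared (Fin n) R
  have h1 : (y * (J (Fin n) R * Bᵀ * J (Fin n) R)).trace = (y * B).trace := by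
    rw [Matrix.mul_assoc, ← Matrix.mul_assoc, ← Matrix.trace_mul_cycle, ← Matrix.trace_transpose]
    simp only [transpose_mul, J_transpose, transpose_transpose, Matrix.mul_neg, Matrix.neg_mul,
      neg_neg]
    rw [← Matrix.mul_assoc, ← Matrix.mul_assoc, mem_sp_matrix.1 hy, ← Matrix.trace_mul_cycle,
      Matrix.mul_neg, Matrix.mul_neg, Matrix.mul_assoc, ← Matrix.mul_assoc (J (Fin n) R), hJ,
      Matrix.trace_mul_comm y]
    simp
  rw [Matrix.mul_add, Matrix.trace_add, h1, two_mul]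

/-- The matrix `c v ⊗ ⟨v, -⟩ + x`. -/
def addSq (c : R) (v : Idx n → R) (x : Matrix (Idx n) (Idx n) R) : Matrix (Idx n) (Idx n) R :=
  x + c • vecMulVec v (corow v)

theorem vecMulVec_corow_mem_sp (v : Idx n → R) :
    vecMulVec v (corow v) ∈ LieAlgebra.Symplectic.sp (Fin n) R := by
  have h1 : J (Fin n) R *ᵥ v = corow v := by
    rw [corow_eq, ← Matrix.vecMul_transpose, J_transpose]
  rw [mem_sp_matrix, Matrix.transpose_vecMulVec, Matrix.vecMulVec_mul, Matrix.mul_neg,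
    Matrix.mul_vecMulVec, h1]
  have h2 : v ᵥ* J (Fin n) R = -corow v := by
    rw [corow_eq, Matrix.vecMul_neg, neg_neg]
  rw [h2, Matrix.vecMulVec_neg]

theorem addSq_mem_sp (c : R) (v : Idx n → R) {x : Matrix (Idx n) (Idx n) R}
    (hx : x ∈ LieAlgebra.Symplectic.sp (Fin n) R) :
    addSq c v x ∈ LieAlgebra.Symplectic.sp (Fin n) R :=
  add_mem hx (SMulMemClass.smul_mem c (vecMulVec_corow_mem_sp v))

theorem trace_addSq_mul (c : R) (v : Idx n → R) (x X : Matrix (Idx n) (Idx n) R) :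
    (addSq c v x * X).trace = (x * X).trace + c * (corow v ⬝ᵥ X *ᵥ v) := by
  rw [addSq, Matrix.add_mul, Matrix.trace_add, Matrix.smul_mul, Matrix.trace_smul,
    Matrix.vecMulVec_mul, Matrix.trace_vecMulVec, Matrix.dotProduct_mulVec, dotProduct_comm,
    smul_eq_mul]

theorem coe_mul_inv (k : symplecticGroup (Fin n) R) :
    (k : Matrix (Idx n) (Idx n) R) * ((k⁻¹ : symplecticGroup (Fin n) R) :
      Matrix (Idx n) (Idx n) R) = 1 := congrArg Subtype.val (mul_inv_cancel k)

theorem coe_inv_mul (k : symplecticGroup (Fin n) R) :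
    ((k⁻¹ : symplecticGroup (Fin n) R) : Matrix (Idx n) (Idx n) R) * k = 1 :=
  congrArg Subtype.val (inv_mul_cancel k)

theorem conj_mem_sp (k : symplecticGroup (Fin n) R) {x : Matrix (Idx n) (Idx n) R}
    (hx : x ∈ LieAlgebra.Symplectic.sp (Fin n) R) :
    (k : Matrix (Idx n) (Idx n) R) * x * ((k⁻¹ : symplecticGroup (Fin n) R) :
      Matrix (Idx n) (Idx n) R) ∈ LieAlgebra.Symplectic.sp (Fin n) R := by
  rw [mem_sp_matrix] at hx ⊢
  set l : Matrix (Idx n) (Idx n) R := ((k⁻¹ : symplecticGroup (Fin n) R) :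
    Matrix (Idx n) (Idx n) R) with hl
  have h1 : lᵀ * J (Fin n) R * l = J (Fin n) R := transpose_mul_J (k⁻¹).2
  have h2 : lᵀ * J (Fin n) R = J (Fin n) R * (k : Matrix (Idx n) (Idx n) R) := by
    conv_rhs => rw [← h1, Matrix.mul_assoc, hl, coe_inv_mul, Matrix.mul_one]
  have h3 : (k : Matrix (Idx n) (Idx n) R)ᵀ * J (Fin n) R = J (Fin n) R * l := by
    conv_rhs => rw [← transpose_mul_J k.2, Matrix.mul_assoc, hl, coe_mul_inv, Matrix.mul_one]
  rw [transpose_mul, transpose_mul, Matrix.mul_assoc, Matrix.mul_assoc, h3,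
    ← Matrix.mul_assoc xᵀ, hx, ← Matrix.mul_assoc, ← Matrix.mul_assoc, h2]
  simp only [Matrix.mul_neg, Matrix.neg_mul, Matrix.mul_assoc]

theorem addSq_conj (k : symplecticGroup (Fin n) R) (c : R) (v : Idx n → R)
    (x : Matrix (Idx n) (Idx n) R) :
    addSq c ((k : Matrix (Idx n) (Idx n) R) *ᵥ v) (k * x * ((k⁻¹ : symplecticGroup (Fin n) R) :
      Matrix (Idx n) (Idx n) R)) = k * addSq c v x * ((k⁻¹ : symplecticGroup (Fin n) R) :
      Matrix (Idx n) (Idx n) R) := by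
  have h : corow ((k : Matrix (Idx n) (Idx n) R) *ᵥ v) =
      corow v ᵥ* ((k⁻¹ : symplecticGroup (Fin n) R) : Matrix (Idx n) (Idx n) R) := by
    rw [← corow_mulVec k.2 v, Matrix.vecMul_vecMul, coe_mul_inv, Matrix.vecMul_one]
  rw [addSq, addSq, h, Matrix.mul_add, Matrix.add_mul, Matrix.mul_smul, Matrix.smul_mul,
    Matrix.mul_vecMulVec, Matrix.vecMulVec_mul]

end Ring

/-! ### The zero fiber of the moment map in coordinates -/

theorem form_eq {n : ℕ} (u v : VF n) : form n u v = corow u ⬝ᵥ v := by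
  rw [form, Matrix.toBilin'_apply', corow_eq, Matrix.dotProduct_mulVec]

/-- The matrix `S²v + x`. -/
abbrev momMat {n : ℕ} (v : VF n) (x : MatF n) : MatF n := addSq (tpow 1) v x

theorem pair_eq {n : ℕ} (v : VF n) (x : MatF n) (X : MatO n) :
    pair v x (toF X *ᵥ v) (toF X) = (momMat v x * toF X).trace.coeff 0 := by
  have h := HahnSeries.coeff_single_mul_add (Γ := ℤ) (r := (1 : ℂ))
    (x := form n v (toF X *ᵥ v)) (a := -1) (b := 1)
  rw [neg_add_cancel, one_mul] at h
  rw [pair, trace_addSq_mul, HahnSeries.coeff_add, add_comm, ← h, form_eq]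

theorem pair_eq_zero {n : ℕ} {v : VF n} {x : MatF n} (h : ∀ i j, momMat v x i j ∈ ord 1)
    (X : MatO n) : pair v x (toF X *ᵥ v) (toF X) = 0 := by
  rw [pair_eq]
  have : (momMat v x * toF X).trace ∈ ord 1 := by
    refine Submodule.sum_mem _ fun i _ => ?_
    rw [Matrix.diag_apply, Matrix.mul_apply]
    refine Submodule.sum_mem _ fun j _ => ?_
    exact add_zero (1 : ℤ) ▸ mul_mem_ord (h i j) (coe_mem_ord (X j i))
  exact this 0 one_pos

theorem mem_zeroFiber_iff {n : ℕ} {p : SpCot n} :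
    p ∈ zeroFiber n ↔ ∀ i j, momMat p.v p.x i j ∈ ord 1 := by
  refine ⟨fun h i j => mem_ord_one_of_coeff fun a => ?_, fun h X => pair_eq_zero h X.1⟩
  have h1 := h ⟨_, add_J_transpose_J_mem_sp (Matrix.single j i a)⟩
  rw [moment, pair_eq] at h1
  have h2 : toF (Matrix.single j i a + J (Fin n) O * (Matrix.single j i a)ᵀ * J (Fin n) O) =
      Matrix.single j i (algebraMap O F a) +
        J (Fin n) F * (Matrix.single j i (algebraMap O F a))ᵀ * J (Fin n) F := by
    have h3 : (Matrix.single j i a).map (algebraMap O F) =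
        Matrix.single j i (algebraMap O F a) := by
      rw [Matrix.map_single]
    rw [toF, Matrix.map_add _ (map_add _), Matrix.map_mul, Matrix.map_mul, map_J,
      Matrix.transpose_map, h3]
  simp only [h2] at h1
  rw [trace_mul_add_J_transpose_J (addSq_mem_sp _ _ p.mem_sp), Matrix.trace_mul_single] at h1
  rw [op_smul_eq_mul, two_mul, HahnSeries.coeff_add, ← two_mul, mul_comm _
    (algebraMap O F a)] at h1
  exact (mul_eq_zero.1 h1).resolve_left two_ne_zero

/-! ### Lattices -/

section Lattice

variable {n : ℕ}

theorem mem_stdLattice {u : VF n} : u ∈ stdLattice n ↔ ∀ i, u i ∈ ord 0 := by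
  constructor
  · rintro ⟨w, rfl⟩ i
    exact coe_mem_ord (w i)
  · intro h
    choose w hw using fun i => mem_ord_zero_iff.1 (h i)
    exact ⟨w, funext hw⟩

theorem mem_dual {L : Submodule O (VF n)} {u : VF n} :
    u ∈ dual L ↔ ∀ w ∈ L, corow u ⬝ᵥ w ∈ ord 0 := by
  refine forall₂_congr fun w _ => ?_
  rw [Submodule.mem_one, form_eq, mem_ord_zero_iff]

theorem lat_mul (g h : MatF n) :
    lat (g * h) = (lat h).map (g.mulVecLin.restrictScalars O) := by
  rw [lat, lat, ← Submodule.map_comp]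
  congr 1
  exact LinearMap.ext fun u => (Matrix.mulVec_mulVec u g h).symm

theorem mem_map_mulVec {g h : MatF n} (hgh : g * h = 1) (hhg : h * g = 1)
    {L : Submodule O (VF n)} {u : VF n} :
    u ∈ L.map (g.mulVecLin.restrictScalars O) ↔ h *ᵥ u ∈ L := by
  constructor
  · rintro ⟨w, hw, rfl⟩
    have : h *ᵥ (g *ᵥ w) = w := by rw [Matrix.mulVec_mulVec, hhg, Matrix.one_mulVec]
    exact this.symm ▸ hw
  · intro hu
    refine ⟨_, hu, ?_⟩
    have : g *ᵥ (h *ᵥ u) = u := by rw [Matrix.mulVec_mulVec, hgh, Matrix.one_mulVec]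
    exact this

theorem mem_lat {g h : MatF n} (hgh : g * h = 1) (hhg : h * g = 1) {u : VF n} :
    u ∈ lat g ↔ ∀ i, (h *ᵥ u) i ∈ ord 0 := by
  rw [lat, mem_map_mulVec hgh hhg, mem_stdLattice]

/-- The diagonal matrix `t^{-c}`. -/
def dia (c : Idx n → ℤ) : MatF n := Matrix.diagonal fun i => tpow (-c i)

theorem dia_mul_dia_neg (c : Idx n → ℤ) : dia c * dia (-c) = 1 := by
  simp only [dia, Matrix.diagonal_mul_diagonal, Pi.neg_apply, tpow_mul_neg, Matrix.diagonal_one]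

theorem dia_neg_mul_dia (c : Idx n → ℤ) : dia (-c) * dia c = 1 := by
  simpa using dia_mul_dia_neg (-c)

theorem mulVec_mem_ord {A : MatF n} {u : VF n} {a : ℤ} {i : Idx n}
    (h : ∀ j, A i j * u j ∈ ord a) : (A *ᵥ u) i ∈ ord a :=
  Submodule.sum_mem (ord a) fun j _ => h j

theorem mem_lat_dia {c : Idx n → ℤ} {u : VF n} : u ∈ lat (dia c) ↔ ∀ i, u i ∈ ord (-c i) := by
  rw [mem_lat (dia_mul_dia_neg c) (dia_neg_mul_dia c)]
  refine forall_congr' fun i => ?_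
  rw [dia, Matrix.mulVec_diagonal, tpow_mul_mem_ord]
  simp

theorem single_mem_lat_dia (c : Idx n → ℤ) (j : Idx n) :
    Pi.single j (tpow (-c j)) ∈ lat (dia c) := by
  rw [mem_lat_dia]
  intro i
  by_cases h : i = j
  · subst h
    rw [Pi.single_eq_same]
    exact tpow_mem_ord _
  · rw [Pi.single_eq_of_ne h]
    exact Submodule.zero_mem _

theorem dual_lat (g : symplecticGroup (Fin n) F) : dual (lat (g : MatF n)) = lat (g : MatF n) := by
  ext u
  have h1 : ∀ w, corow u ⬝ᵥ ((g : MatF n) *ᵥ w) =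
      corow (((g⁻¹ : symplecticGroup (Fin n) F) : MatF n) *ᵥ u) ⬝ᵥ w := by
    intro w
    rw [← corow_mulVec (g⁻¹).2 u, Matrix.dotProduct_mulVec, Matrix.vecMul_vecMul, coe_inv_mul,
      Matrix.vecMul_one]
  rw [mem_dual, mem_lat (coe_mul_inv g) (coe_inv_mul g)]
  set u' := ((g⁻¹ : symplecticGroup (Fin n) F) : MatF n) *ᵥ u
  have h2 : (∀ w ∈ lat (g : MatF n), corow u ⬝ᵥ w ∈ ord 0) ↔
      ∀ w ∈ stdLattice n, corow u' ⬝ᵥ w ∈ ord 0 := by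
    constructor
    · intro h w hw
      rw [← h1]
      exact h _ ⟨w, hw, rfl⟩
    · rintro h _ ⟨w, hw, rfl⟩
      exact (h1 w).symm ▸ h w hw
  rw [h2]
  constructor
  · intro h i
    have h3 := h (Pi.single (Sum.swap i) 1) (mem_stdLattice.2 fun j => by
      by_cases hj : j = Sum.swap i
      · rw [hj, Pi.single_eq_same]
        exact tpow_mem_ord 0
      · rw [Pi.single_eq_of_ne hj]
        exact Submodule.zero_mem _)
    rw [dotProduct_single_one] at h3
    rcases i with i | i
    · exact h3
    · exact neg_neg (u' (Sum.inr i)) ▸ (ord 0).neg_mem h3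
  · intro h w hw
    refine Submodule.sum_mem _ fun i _ => add_zero (0 : ℤ) ▸ mul_mem_ord ?_ (mem_stdLattice.1 hw i)
    rcases i with i | i
    · exact (ord 0).neg_mem (h _)
    · exact h _

theorem isLattice_lat (g : symplecticGroup (Fin n) F) : (lat (g : MatF n)).IsLattice F where
  fg := by
    refine Submodule.FG.map _ ?_
    rw [stdLattice, LinearMap.range_eq_map]
    exact Module.Finite.fg_top.map _
  span_eq_top := by
    rw [eq_top_iff]
    intro u _
    have h1 : u = ∑ i, (((g⁻¹ : symplecticGroup (Fin n) F) : MatF n) *ᵥ u) i •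
        ((g : MatF n) *ᵥ Pi.single i 1) := by
      simp only [← Matrix.mulVec_smul, ← Matrix.mulVec_sum]
      have : ∑ i, (((g⁻¹ : symplecticGroup (Fin n) F) : MatF n) *ᵥ u) i • Pi.single i (1 : F) =
          ((g⁻¹ : symplecticGroup (Fin n) F) : MatF n) *ᵥ u := by
        ext1 j
        simp [Pi.single_apply]
      rw [this, Matrix.mulVec_mulVec, coe_mul_inv, Matrix.one_mulVec]
    rw [h1]
    refine Submodule.sum_mem _ fun i _ => Submodule.smul_mem _ _ (Submodule.subset_span ?_)
    refine ⟨Pi.single i 1, mem_stdLattice.2 fun j => ?_, rfl⟩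
    by_cases hj : j = i
    · rw [hj, Pi.single_eq_same]
      exact tpow_mem_ord 0
    · rw [Pi.single_eq_of_ne hj]
      exact Submodule.zero_mem _

theorem mapsIntoT_map {g h : MatF n} (hhg : h * g = 1) {x : MatF n}
    {L : Submodule O (VF n)} (hx : MapsIntoT x L) :
    MapsIntoT (g * x * h) (L.map (g.mulVecLin.restrictScalars O)) := by
  rintro _ ⟨u, hu, rfl⟩
  obtain ⟨w, hw, hxw⟩ := hx u hu
  refine ⟨_, ⟨w, hw, rfl⟩, ?_⟩
  have h1 : (g * x * h) *ᵥ (g *ᵥ u) = g *ᵥ (x *ᵥ u) := by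
    rw [Matrix.mulVec_mulVec, Matrix.mul_assoc, hhg, Matrix.mul_one, Matrix.mulVec_mulVec]
  have h2 : g *ᵥ (t • w) = t • (g *ᵥ w) := 
    (g.mulVecLin.restrictScalars O).map_smul t w
  rw [← hxw] at h2
  exact h1.trans h2

theorem mapsIntoT_dia {c : Idx n → ℤ} {x : MatF n} :
    MapsIntoT x (lat (dia c)) ↔ ∀ i j, x i j ∈ ord (1 + c j - c i) := by
  constructor
  · intro h i j
    obtain ⟨w, hw, hxw⟩ := h _ (single_mem_lat_dia c j)
    have h1 := congrFun hxw i
    rw [Matrix.mulVec_single, Pi.smul_apply, Pi.smul_apply, t_smul, Matrix.col_apply,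
      op_smul_eq_mul, mul_comm] at h1
    have h2 : tpow (-c j) * x i j ∈ ord (1 - c i) := by
      rw [h1, tpow_mul_mem_ord, sub_sub_cancel_left]
      exact mem_lat_dia.1 hw i
    rw [tpow_mul_mem_ord] at h2
    convert h2 using 2
    ring
  · intro h u hu
    refine ⟨fun i => tpow (-1) * (x *ᵥ u) i, mem_lat_dia.2 fun i => ?_, ?_⟩
    · rw [tpow_mul_mem_ord]
      refine mulVec_mem_ord fun j => ?_
      have := mul_mem_ord (h i j) (mem_lat_dia.1 hu j)
      convert this using 2
      ring
    · ext1 i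
      rw [Pi.smul_apply, t_smul, ← mul_assoc, tpow_mul_neg, one_mul]

/-! ### Points of `V_𝐅 × T^*Gr_G` in coordinates -/

/-- An integral symplectic matrix regarded as a symplectic matrix over `ℂ((t))`. -/
def toSp : symplecticGroup (Fin n) O →* symplecticGroup (Fin n) F where
  toFun k := ⟨toF k.1, SymplecticGroup.map_mem k.2 (algebraMap O F)⟩
  map_one' := Subtype.ext (Matrix.map_one _ (map_zero _) (map_one _))
  map_mul' _ _ := Subtype.ext (Matrix.map_mul)

theorem toSp_apply_mem_ord (k : symplecticGroup (Fin n) O) (i j : Idx n) :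
    (toSp k : MatF n) i j ∈ ord 0 := coe_mem_ord _

theorem toSp_mul_inv (k : symplecticGroup (Fin n) O) :
    (toSp k : MatF n) * (toSp k⁻¹ : MatF n) = 1 := by
  rw [map_inv, coe_mul_inv]

theorem toSp_inv_mul (k : symplecticGroup (Fin n) O) :
    (toSp k⁻¹ : MatF n) * (toSp k : MatF n) = 1 := by
  rw [map_inv, coe_inv_mul]

/-- `c` changes its sign under the duality of the index set. -/
def IsOdd (c : Idx n → ℤ) : Prop := ∀ i, c (Sum.swap i) = -c i

theorem dia_mem_symplecticGroup {c : Idx n → ℤ} (hc : IsOdd c) :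
    dia c ∈ symplecticGroup (Fin n) F := by
  rw [SymplecticGroup.mem_iff, dia, Matrix.diagonal_transpose]
  have h1 : ∀ i, c (Sum.inr i) = -c (Sum.inl i) := fun i => hc (Sum.inl i)
  ext i j : 2
  rw [Matrix.mul_diagonal, Matrix.diagonal_mul]
  rcases i with i | i <;> rcases j with j | j
  · simp [J]
  · by_cases hij : i = j
    · subst hij
      have h2 : tpow (-c (Sum.inl i)) * -1 * tpow (c (Sum.inl i)) = -1 := by
        linear_combination -tpow_neg_mul (c (Sum.inl i))
      simpa [J, h1] using congrArg HahnSeries.coeff h2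
    · simp [J, hij]
  · by_cases hij : i = j
    · subst hij
      simp [J, h1]
    · simp [J, hij]
  · simp [J]

/-- The matrix `k t^{-c}`. -/
def frame (k : symplecticGroup (Fin n) O) {c : Idx n → ℤ} (hc : IsOdd c) :
    symplecticGroup (Fin n) F := toSp k * ⟨dia c, dia_mem_symplecticGroup hc⟩

theorem frame_coe (k : symplecticGroup (Fin n) O) {c : Idx n → ℤ} (hc : IsOdd c) :
    (frame k hc : MatF n) = (toSp k : MatF n) * dia c := rfl

/-- The translate by `k` of the point `(v, t^{-c} V_𝐎, x)`. -/
def pt (k : symplecticGroup (Fin n) O) {c : Idx n → ℤ} (hc : IsOdd c) (v : VF n) {x : MatF n}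
    (hx : x ∈ LieAlgebra.Symplectic.sp (Fin n) F) (hn : ∀ i j, x i j ∈ ord (1 + c j - c i)) :
    SpCot n where
  v := (toSp k : MatF n) *ᵥ v
  L := lat (frame k hc : MatF n)
  x := (toSp k : MatF n) * x * (toSp k⁻¹ : MatF n)
  isLattice := isLattice_lat _
  selfDual := dual_lat _
  mem_sp := by
    rw [map_inv]
    exact conj_mem_sp _ hx
  nil := by
    rw [frame_coe, lat_mul]
    exact mapsIntoT_map (toSp_inv_mul k) (mapsIntoT_dia.2 hn)

theorem exists_eq_pt (p : SpCot n) {k : symplecticGroup (Fin n) O} {c : Idx n → ℤ} (hc : IsOdd c)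
    (hL : p.L = lat (frame k hc : MatF n)) :
    ∃ (x : MatF n) (hx : x ∈ LieAlgebra.Symplectic.sp (Fin n) F)
      (hn : ∀ i j, x i j ∈ ord (1 + c j - c i)),
      p = pt k hc ((toSp k⁻¹ : MatF n) *ᵥ p.v) hx hn := by
  have h1 := toSp_mul_inv k
  have h2 := toSp_inv_mul k
  have hx : (toSp k⁻¹ : MatF n) * p.x * (toSp k : MatF n) ∈
      LieAlgebra.Symplectic.sp (Fin n) F := by
    have := conj_mem_sp (toSp k⁻¹) p.mem_sp
    rwa [← map_inv, inv_inv] at this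
  have hL' : p.L.map ((toSp k⁻¹ : MatF n).mulVecLin.restrictScalars O) = lat (dia c) := by
    rw [hL, ← lat_mul, frame_coe, ← Matrix.mul_assoc, h2, Matrix.one_mul]
  refine ⟨_, hx, mapsIntoT_dia.1 (hL' ▸ mapsIntoT_map h1 p.nil), ?_⟩
  obtain ⟨v, L, x, _, _, _, _⟩ := p
  simp only [pt, SpCot.mk.injEq]
  refine ⟨?_, hL, ?_⟩
  · rw [Matrix.mulVec_mulVec, h1, Matrix.one_mulVec]
  · rw [← Matrix.mul_assoc, ← Matrix.mul_assoc, h1, Matrix.one_mul, Matrix.mul_assoc, h1,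
      Matrix.mul_one]

theorem mul_apply_mem_ord {A B : MatF n} {a b : ℤ} (hA : ∀ i j, A i j ∈ ord a)
    (hB : ∀ i j, B i j ∈ ord b) (i j : Idx n) : (A * B) i j ∈ ord (a + b) :=
  Submodule.sum_mem _ fun l _ => mul_mem_ord (hA i l) (hB l j)

theorem momMat_conj_mem_ord (k : symplecticGroup (Fin n) O) {v : VF n} {x : MatF n}
    (h : ∀ i j, momMat v x i j ∈ ord 1) (i j : Idx n) :
    momMat ((toSp k : MatF n) *ᵥ v) ((toSp k : MatF n) * x * (toSp k⁻¹ : MatF n)) i j ∈ ord 1 := by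
  rw [map_inv, momMat, addSq_conj, ← map_inv]
  exact mul_apply_mem_ord (a := 0 + 1) (b := 0)
    (mul_apply_mem_ord (toSp_apply_mem_ord k) h) (toSp_apply_mem_ord k⁻¹) i j

theorem pt_mem_zeroFiber_iff {k : symplecticGroup (Fin n) O} {c : Idx n → ℤ} {hc : IsOdd c}
    {v : VF n} {x : MatF n} {hx : x ∈ LieAlgebra.Symplectic.sp (Fin n) F}
    {hn : ∀ i j, x i j ∈ ord (1 + c j - c i)} :
    pt k hc v hx hn ∈ zeroFiber n ↔ ∀ i j, momMat v x i j ∈ ord 1 := by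
  rw [mem_zeroFiber_iff]
  refine ⟨fun h => ?_, fun h => momMat_conj_mem_ord k h⟩
  have := momMat_conj_mem_ord k⁻¹ h
  have h1 : (toSp k⁻¹ : MatF n) *ᵥ (pt k hc v hx hn).v = v := by
    rw [pt, Matrix.mulVec_mulVec, toSp_inv_mul, Matrix.one_mulVec]
  have h2 : (toSp k⁻¹ : MatF n) * (pt k hc v hx hn).x * (toSp k⁻¹⁻¹ : MatF n) = x := by
    rw [pt, inv_inv, ← Matrix.mul_assoc, ← Matrix.mul_assoc, toSp_inv_mul, Matrix.one_mul,
      Matrix.mul_assoc, toSp_inv_mul, Matrix.mul_one]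
  rwa [h1, h2] at this

end Lattice

/-! ### Symplectic transvections -/

section Transvection

variable {n : ℕ} {R : Type} [CommRing R]

theorem corow_dotProduct_self (u : Idx n → R) : corow u ⬝ᵥ u = 0 := by
  rw [dotProduct, Fintype.sum_sum_type, ← Finset.sum_add_distrib]
  refine Finset.sum_eq_zero fun i _ => ?_
  simp only [corow, Sum.elim_inl, Sum.elim_inr]
  ring

theorem corow_dotProduct_comm (u v : Idx n → R) : corow u ⬝ᵥ v = -(corow v ⬝ᵥ u) := by
  rw [dotProduct, dotProduct, Fintype.sum_sum_type, Fintype.sum_sum_type,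
    ← Finset.sum_add_distrib, ← Finset.sum_add_distrib, ← Finset.sum_neg_distrib]
  refine Finset.sum_congr rfl fun i _ => ?_
  simp only [corow, Sum.elim_inl, Sum.elim_inr]
  ring

theorem corow_sub (u v : Idx n → R) : corow (u - v) = corow u - corow v := by
  rw [corow_eq, corow_eq, corow_eq, Matrix.sub_vecMul]

/-- The symplectic transvection `z ↦ z + a ⟨u, z⟩ u`. -/
def transvection (u : Idx n → R) (a : R) : symplecticGroup (Fin n) R :=
  ⟨1 + a • vecMulVec u (corow u), by
    have h1 := mem_sp_matrix.1 (vecMulVec_corow_mem_sp u)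
    have h2 : vecMulVec u (corow u) * vecMulVec u (corow u) = 0 := by
      rw [Matrix.vecMulVec_mul_vecMulVec, corow_dotProduct_self, zero_smul, vecMulVec_zero]
    rw [SymplecticGroup.mem_iff', transpose_add, transpose_one, transpose_smul, Matrix.add_mul,
      Matrix.smul_mul, h1, Matrix.one_mul, Matrix.mul_neg, Matrix.mul_add, Matrix.mul_one,
      Matrix.add_mul, Matrix.smul_mul, Matrix.neg_mul, Matrix.mul_smul, Matrix.mul_smul,
      Matrix.mul_assoc, h2]
    simp⟩

theorem transvection_mulVec (u : Idx n → R) (a : R) (z : Idx n → R) :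
    (transvection u a : Matrix (Idx n) (Idx n) R) *ᵥ z = z + (a * (corow u ⬝ᵥ z)) • u := by
  rw [transvection, Matrix.add_mulVec, Matrix.one_mulVec, Matrix.smul_mulVec,
    Matrix.vecMulVec_mulVec]
  ext i
  simp only [Pi.add_apply, Pi.smul_apply, smul_eq_mul, op_smul_eq_mul]
  ring

end Transvection

/-! ### Integral symplectic matrices joined to the identity by a curve -/

section Joined

variable {n : ℕ}

theorem toSp_mul (k l : symplecticGroup (Fin n) O) :
    (toSp (k * l) : MatF n) = (toSp k : MatF n) * (toSp l : MatF n) := by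
  rw [map_mul]
  rfl

theorem toSp_inv (k : symplecticGroup (Fin n) O) :
    (toSp k⁻¹ : MatF n) = -J (Fin n) F * (toSp k : MatF n)ᵀ * J (Fin n) F := by
  rw [map_inv]
  rfl

/-- The integral symplectic matrices that are joined to the identity by a curve with polynomial
coefficients. -/
def joinedGroup (n : ℕ) : Subgroup (symplecticGroup (Fin n) O) where
  carrier := {k | ∃ h : ℂ → symplecticGroup (Fin n) O,
    h 0 = 1 ∧ h 1 = k ∧ IsMatFam polyFun fun s => (toSp (h s) : MatF n)}
  one_mem' := ⟨fun _ => 1, rfl, rfl, IsMatFam.const _⟩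
  mul_mem' := by
    rintro _ _ ⟨h, h0, rfl, hh⟩ ⟨g, g0, rfl, hg⟩
    refine ⟨fun s => h s * g s, by simp only [h0, g0, one_mul], rfl, ?_⟩
    simpa only [toSp_mul] using hh.mul hg
  inv_mem' := by
    rintro _ ⟨h, h0, rfl, hh⟩
    refine ⟨fun s => (h s)⁻¹, by simp only [h0, inv_one], rfl, ?_⟩
    simpa only [toSp_inv] using
      ((IsMatFam.const (-J (Fin n) F)).mul hh.transpose).mul (IsMatFam.const (J (Fin n) F))

theorem curve_mem_joinedGroup {h : ℂ → symplecticGroup (Fin n) O} (h0 : h 0 = 1)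
    (hh : IsMatFam polyFun fun s => (toSp (h s) : MatF n)) (s : ℂ) : h s ∈ joinedGroup n := by
  refine ⟨fun r => h (r * s), by simp only [zero_mul, h0], by simp only [one_mul], fun i j => ?_⟩
  have := laurentFam_polyFun_comp (hh i j) (Polynomial.X * Polynomial.C s)
  simpa only [Polynomial.eval_mul, Polynomial.eval_X, Polynomial.eval_C] using this

theorem transvection_mem_joinedGroup (u : Idx n → O) (a : O) :
    transvection u a ∈ joinedGroup n := by
  refine ⟨fun s => transvection u (PowerSeries.C s * a), ?_, ?_, fun i j => ?_⟩
  · apply Subtype.ext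
    simp [transvection]
  · simp
  · have h1 : (fun s : ℂ => (toSp (transvection u (PowerSeries.C s * a)) : MatF n) i j) =
        (fun _ => algebraMap O F ((1 : MatO n) i j)) +
          (fun s => (HahnSeries.C s : F)) * fun _ => algebraMap O F (a * (u i * corow u j)) := by
      ext1 s
      have h2 : (toSp (transvection u (PowerSeries.C s * a)) : MatF n) i j =
          algebraMap O F ((1 : MatO n) i j + PowerSeries.C s * a * (u i * corow u j)) := rfl
      have h3 : (algebraMap O F (PowerSeries.C s)) = (HahnSeries.C s : F) := PowerSeries.coe_C s
      rw [h2, map_add, mul_assoc, map_mul, h3]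
      rfl
    rw [h1]
    exact add_mem (laurentFam_const _ _) (mul_mem
      (laurentFam_C ⟨Polynomial.X, fun s => by simp⟩) (laurentFam_const _ _))

/-- The position of a basis vector in its half of the basis. -/
def pos : Idx n → ℕ := Sum.elim (fun i => i) (fun i => i)

@[simp] theorem pos_inl (i : Fin n) : pos (Sum.inl i) = i := rfl
@[simp] theorem pos_inr (i : Fin n) : pos (Sum.inr i) = i := rfl

/-- The vector is a combination of the basis vectors in positions at least `j`. -/
def VanishesBelow {R : Type} [Zero R] (j : ℕ) (v : Idx n → R) : Prop := ∀ b, pos b < j → v b = 0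

/-- `k` acts as the identity on the span of the basis vectors in positions below `j` and preserves
the span of the other ones. -/
def FixesBelow (j : ℕ) (k : symplecticGroup (Fin n) O) : Prop :=
  (∀ (z : VF n) b, pos b < j → ((toSp k : MatF n) *ᵥ z) b = z b) ∧
    ∀ b (a : F), pos b < j → (toSp k : MatF n) *ᵥ Pi.single b a = Pi.single b a

theorem FixesBelow.mul {j : ℕ} {k l : symplecticGroup (Fin n) O} (hk : FixesBelow j k)
    (hl : FixesBelow j l) : FixesBelow j (k * l) := by
  have h := toSp_mul k l
  constructor
  · intro z b hb
    rw [h, ← Matrix.mulVec_mulVec, hk.1 _ _ hb, hl.1 _ _ hb]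
  · intro b a hb
    rw [h, ← Matrix.mulVec_mulVec, hl.2 _ _ hb, hk.2 _ _ hb]

theorem toSp_transvection (u : Idx n → O) (a : O) :
    toSp (transvection u a) = transvection (fun i => algebraMap O F (u i)) (algebraMap O F a) := by
  apply Subtype.ext
  ext1 i j
  have h1 : corow (fun i => algebraMap O F (u i)) j = algebraMap O F (corow u j) := by
    rcases j with j | j
    · exact (map_neg _ _).symm
    · rfl
  change algebraMap O F ((1 : MatO n) i j + a * (u i * corow u j)) =
    (1 : MatF n) i j + algebraMap O F a * (algebraMap O F (u i) * corow _ j)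
  rw [h1, map_add, map_mul, map_mul, Matrix.one_apply, Matrix.one_apply, apply_ite (algebraMap O F),
    map_one, map_zero]

theorem fixesBelow_transvection {j : ℕ} {u : Idx n → O} (hu : VanishesBelow j u) (a : O) :
    FixesBelow j (transvection u a) := by
  constructor
  · intro z b hb
    rw [toSp_transvection, transvection_mulVec, Pi.add_apply, Pi.smul_apply, hu b hb, map_zero]
    exact (congrArg _ (mul_zero _)).trans (add_zero _)
  · intro b c hb
    have h1 : corow (fun i => algebraMap O F (u i)) b = 0 := by
      rcases b with b | b
      · exact neg_eq_zero.2 ((congrArg _ (hu (Sum.inr b) hb)).trans (map_zero _))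
      · exact (congrArg _ (hu (Sum.inl b) hb)).trans (map_zero _)
    rw [toSp_transvection, transvection_mulVec, dotProduct_single, h1, zero_mul, mul_zero,
      zero_smul, add_zero]

theorem exists_transvection {j : ℕ} {f e : Idx n → O} (hf : VanishesBelow j f)
    (he : VanishesBelow j e) (hu : IsUnit (corow f ⬝ᵥ e)) :
    ∃ k ∈ joinedGroup n, FixesBelow j k ∧ (k : MatO n) *ᵥ f = e := by
  obtain ⟨q, hq⟩ := hu
  have hv : VanishesBelow j (f - e) := fun b hb => by
    rw [Pi.sub_apply, hf b hb, he b hb, sub_zero]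
  refine ⟨transvection (f - e) (-(q⁻¹ : Oˣ)), transvection_mem_joinedGroup _ _,
    fixesBelow_transvection hv _, ?_⟩
  rw [transvection_mulVec, corow_sub, sub_dotProduct, corow_dotProduct_self,
    corow_dotProduct_comm e f, ← hq, zero_sub, neg_neg, neg_mul, Units.inv_mul, neg_one_smul]
  abel

/-- The integral symplectic group acts transitively on primitive vectors. -/
theorem exists_mulVec_eq_single {j : Fin n} {f : Idx n → O} (hf : VanishesBelow j f) {b : Idx n}
    (hb : PowerSeries.constantCoeff (f b) ≠ 0) :
    ∃ k ∈ joinedGroup n, FixesBelow j k ∧ (k : MatO n) *ᵥ f = Pi.single (Sum.inl j) 1 := by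
  have hsingle : ∀ c : Idx n, ¬ pos c < (j : ℕ) → VanishesBelow (j : ℕ) (Pi.single c (1 : O)) := by
    intro c hc d hd
    rw [Pi.single_eq_of_ne]
    rintro rfl
    exact hc hd
  have he : VanishesBelow (j : ℕ) (Pi.single (Sum.inl j) (1 : O)) := hsingle _ (lt_irrefl _)
  suffices h : ∃ h : Idx n → O, VanishesBelow j h ∧ IsUnit (corow f ⬝ᵥ h) ∧
      IsUnit (corow h ⬝ᵥ Pi.single (Sum.inl j) 1) by
    obtain ⟨h, h1, h2, h3⟩ := h
    obtain ⟨k, hk, hk', hkf⟩ := exists_transvection hf h1 h2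
    obtain ⟨l, hl, hl', hlf⟩ := exists_transvection h1 he h3
    refine ⟨l * k, mul_mem hl hk, hl'.mul hk', ?_⟩
    rw [Submonoid.coe_mul, ← Matrix.mulVec_mulVec, hkf, hlf]
  by_cases hj : PowerSeries.constantCoeff (f (Sum.inl j)) = 0
  · have hbj : b ≠ Sum.inl j := fun h => hb (h ▸ hj)
    have hbp : ¬ pos b < (j : ℕ) := fun h => hb (by rw [hf b h, map_zero])
    refine ⟨Pi.single (Sum.swap b) 1 + Pi.single (Sum.inr j) 1, ?_, ?_, ?_⟩
    · intro d hd
      rw [Pi.add_apply, hsingle (Sum.swap b) (by rcases b with b | b <;> exact hbp) d hd,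
        hsingle (Sum.inr j) (lt_irrefl _) d hd, add_zero]
    · apply isUnit_of_coeff_ne
      rw [dotProduct_add, dotProduct_single_one, dotProduct_single_one, map_add]
      have : PowerSeries.constantCoeff (corow f (Sum.inr j)) = 0 := hj
      rw [this, add_zero]
      rcases b with b | b
      · exact hb
      · simpa [corow] using hb
    · apply isUnit_of_coeff_ne
      rw [dotProduct_single_one]
      have : Sum.inr j ≠ Sum.swap b := by
        rcases b with b | b
        · intro h
          exact hbj (congrArg Sum.inl (Sum.inr.inj h).symm)
        · exact Sum.inr_ne_inl
      simp [corow, Pi.single_eq_of_ne this]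
  · refine ⟨Pi.single (Sum.inr j) 1, hsingle _ (lt_irrefl _), ?_, ?_⟩
    · apply isUnit_of_coeff_ne
      rw [dotProduct_single_one]
      exact hj
    · apply isUnit_of_coeff_ne
      rw [dotProduct_single_one]
      simp [corow]

end Joined

/-! ### The Cartan decomposition -/

section Cartan

variable {n : ℕ}

theorem corow_single_inl (i : Fin n) (a : F) (w : VF n) :
    corow (Pi.single (Sum.inl i) a) ⬝ᵥ w = a * w (Sum.inr i) := by
  have : corow (Pi.single (Sum.inl i) a : VF n) = Pi.single (Sum.inr i) a := by
    ext1 b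
    rcases b with b | b
    · simp [corow]
    · simp [corow, Pi.single_apply]
  rw [this, single_dotProduct]

theorem corow_single_inr (i : Fin n) (a : F) (w : VF n) :
    corow (Pi.single (Sum.inr i) a) ⬝ᵥ w = -(a * w (Sum.inl i)) := by
  have : corow (Pi.single (Sum.inr i) a : VF n) = -Pi.single (Sum.inl i) a := by
    ext1 b
    rcases b with b | b
    · simp [corow, Pi.single_apply]
    · simp [corow]
  rw [this, neg_dotProduct, single_dotProduct]

theorem dual_map {g h : MatF n} (hg : g ∈ symplecticGroup (Fin n) F) (hgh : g * h = 1)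
    (hhg : h * g = 1) {L : Submodule O (VF n)} (hL : dual L = L) :
    dual (L.map (g.mulVecLin.restrictScalars O)) = L.map (g.mulVecLin.restrictScalars O) := by
  ext u
  have h1 : ∀ w, corow u ⬝ᵥ (g *ᵥ w) = corow (h *ᵥ u) ⬝ᵥ w := by
    intro w
    rw [Matrix.dotProduct_mulVec, ← corow_mulVec hg (h *ᵥ u), Matrix.mulVec_mulVec, hgh,
      Matrix.one_mulVec]
  rw [mem_dual, mem_map_mulVec hgh hhg]
  conv_rhs => rw [← hL, mem_dual]
  constructor
  · intro H w hw
    rw [← h1]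
    exact H _ ⟨w, hw, rfl⟩
  · rintro H _ ⟨w, hw, rfl⟩
    exact (h1 w).symm ▸ H w hw

theorem single_mem_of_mem_ord {L : Submodule O (VF n)} {b : Idx n} {m : ℤ}
    (h : Pi.single b (tpow m) ∈ L) {a : F} (ha : a ∈ ord m) : Pi.single b a ∈ L := by
  have h1 : tpow (-m) * a ∈ ord 0 := tpow_mul_mem_ord.2 (by simpa using ha)
  obtain ⟨c, hc⟩ := mem_ord_zero_iff.1 h1
  have h2 : Pi.single b a = c • (Pi.single b (tpow m) : VF n) := by
    ext1 d
    rw [Pi.smul_apply, Algebra.smul_def, hc]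
    by_cases hd : d = b
    · subst hd
      rw [Pi.single_eq_same, Pi.single_eq_same, mul_right_comm, tpow_neg_mul, one_mul]
    · rw [Pi.single_eq_of_ne hd, Pi.single_eq_of_ne hd, mul_zero]
  rw [h2]
  exact L.smul_mem c h

/-- The lattice `L` splits off the lines spanned by the first `j` pairs of basis vectors, with
exponents `γ`, and what remains is contained in the multiples of the standard lattice by the
corresponding powers of the uniformizer. -/
def SplitsBelow (j : ℕ) (γ : Fin n → ℕ) (L : Submodule O (VF n)) : Prop :=
  ∀ i : Fin n, (i : ℕ) < j → Pi.single (Sum.inl i) (tpow (-γ i)) ∈ L ∧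
    Pi.single (Sum.inr i) (tpow (γ i)) ∈ L ∧
    ∀ w ∈ L, VanishesBelow i w → ∀ b, w b ∈ ord (-γ i)

/-- The odd function on the index set given by its values on the first half. -/
def odd (γ : Fin n → ℤ) : Idx n → ℤ := Sum.elim γ (-γ)

theorem isOdd_odd (γ : Fin n → ℤ) : IsOdd (odd γ) := by
  rintro (i | i)
  · rfl
  · exact (neg_neg _).symm

variable {j : ℕ} {γ : Fin n → ℕ} {L : Submodule O (VF n)}

theorem SplitsBelow.single_mem (h : SplitsBelow j γ L) {b : Idx n} (hb : pos b < j) :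
    Pi.single b (tpow (-odd (fun i => (γ i : ℤ)) b)) ∈ L := by
  rcases b with i | i
  · exact (h i hb).1
  · exact (neg_neg (γ i : ℤ)).symm ▸ (h i hb).2.1

theorem SplitsBelow.apply_mem_ord (h : SplitsBelow j γ L) (hL : dual L = L) {w : VF n}
    (hw : w ∈ L) {b : Idx n} (hb : pos b < j) : w b ∈ ord (-odd (fun i => (γ i : ℤ)) b) := by
  rcases b with i | i
  · have h1 := (h i hb).2.1
    rw [← hL, mem_dual] at h1
    have h2 := h1 w hw
    rwa [corow_single_inr, Submodule.neg_mem_iff, tpow_mul_mem_ord, zero_sub] at h2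
  · have h1 := (h i hb).1
    rw [← hL, mem_dual] at h1
    have h2 := h1 w hw
    rwa [corow_single_inl, tpow_mul_mem_ord, zero_sub] at h2

/-- The projection of `V_𝐅` to the span of the basis vectors in positions at least `j`. -/
def cut (j : ℕ) (w : VF n) : VF n := fun b => if pos b < j then 0 else w b

theorem vanishesBelow_cut (j : ℕ) (w : VF n) : VanishesBelow j (cut j w) := fun _ hb => if_pos hb

theorem cut_apply {b : Idx n} (hb : ¬ pos b < j) (w : VF n) : cut j w b = w b := if_neg hb

theorem SplitsBelow.cut_mem (h : SplitsBelow j γ L) (hL : dual L = L) {w : VF n} (hw : w ∈ L) :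
    cut j w ∈ L := by
  have h1 : cut j w = w - ∑ b : Idx n, if pos b < j then Pi.single b (w b) else 0 := by
    ext1 d
    rw [Pi.sub_apply, Finset.sum_apply, Finset.sum_eq_single d, cut]
    · split_ifs
      · rw [Pi.single_eq_same, sub_self]
      · rw [Pi.zero_apply, sub_zero]
    · intro b _ hbd
      split_ifs
      · exact Pi.single_eq_of_ne hbd.symm _
      · rfl
    · exact fun h => (h (Finset.mem_univ _)).elim
  rw [h1]
  refine L.sub_mem hw (L.sum_mem fun b _ => ?_)
  split_ifs with hb
  · exact single_mem_of_mem_ord (h.single_mem hb) (h.apply_mem_ord hL hw hb)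
  · exact L.zero_mem

theorem exists_ord_of_fg (hL : L.FG) : ∃ N : ℕ, ∀ w ∈ L, ∀ b, w b ∈ ord (-N) := by
  obtain ⟨S, rfl⟩ := hL
  obtain ⟨N, hN⟩ := exists_uniform_ord (X := Idx n) (κ := S) (f := fun u b => u.1 b) fun u => by
    obtain ⟨N, hN⟩ := exists_uniform_ord (X := Unit) (κ := Idx n) (f := fun b _ => u.1 b)
      fun b => (exists_mem_ord _).imp fun _ h _ => h
    exact ⟨_, fun b => hN b ()⟩
  refine ⟨N, fun w hw b => ?_⟩
  induction hw using Submodule.span_induction with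
  | mem u hu => exact hN ⟨u, hu⟩ b
  | zero => exact Submodule.zero_mem _
  | add x y _ _ hx hy => exact Submodule.add_mem _ hx hy
  | smul a x _ hx => exact Submodule.smul_mem _ a hx

theorem SplitsBelow.map {k : symplecticGroup (Fin n) O} (hk : FixesBelow j k)
    (h : SplitsBelow j γ L) :
    SplitsBelow j γ (L.map ((toSp k : MatF n).mulVecLin.restrictScalars O)) := by
  intro i hi
  obtain ⟨h1, h2, h3⟩ := h i hi
  refine ⟨⟨_, h1, hk.2 _ _ hi⟩, ⟨_, h2, hk.2 _ _ hi⟩, ?_⟩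
  rintro _ ⟨w, hw, rfl⟩ hv b
  have hw' : VanishesBelow (i : ℕ) w := fun d hd =>
    (hk.1 w d (hd.trans hi)).symm.trans (hv d hd)
  refine mulVec_mem_ord fun d => ?_
  exact zero_add (-(γ i : ℤ)) ▸ mul_mem_ord (toSp_apply_mem_ord k b d) (h3 w hw hw' d)

theorem SplitsBelow.exists_succ (h : SplitsBelow j γ L) (hL : dual L = L) (hfg : L.FG)
    (hj : j < n) : ∃ k ∈ joinedGroup n, ∃ γ' : Fin n → ℕ,
      SplitsBelow (j + 1) γ' (L.map ((toSp k : MatF n).mulVecLin.restrictScalars O)) := by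
  classical
  set j₀ : Fin n := ⟨j, hj⟩ with hj₀
  have hex : ∃ N : ℕ, ∀ w ∈ L, VanishesBelow j w → ∀ b, w b ∈ ord (-N) :=
    (exists_ord_of_fg hfg).imp fun N hN w hw _ => hN w hw
  set N := Nat.find hex with hN
  have hNspec := Nat.find_spec hex
  rw [← hN] at hNspec
  obtain ⟨f₀, hf₀, hv, b, hb⟩ : ∃ f ∈ L, VanishesBelow j f ∧ ∃ b, (f b).coeff (-N) ≠ 0 := by
    rcases Nat.eq_zero_or_pos N with h0 | h0
    · refine ⟨Pi.single (Sum.inl j₀) 1, ?_, ?_, Sum.inl j₀, ?_⟩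
      · rw [← hL, mem_dual]
        intro w hw
        rw [corow_single_inl, one_mul, ← cut_apply (lt_irrefl j) w]
        have := hNspec _ (h.cut_mem hL hw) (vanishesBelow_cut _ _) (Sum.inr j₀)
        simpa [h0] using this
      · intro d hd
        rw [Pi.single_eq_of_ne]
        rintro rfl
        exact lt_irrefl _ hd
      · rw [Pi.single_eq_same, h0]
        simp
    · have := Nat.find_min hex (m := N - 1) (by omega)
      push Not at this
      obtain ⟨w, hw, hv, b, hb⟩ := this
      refine ⟨w, hw, hv, b, fun h0 => hb fun m hm => ?_⟩
      rcases lt_or_eq_of_le (show m ≤ -(N : ℤ) by omega) with h1 | rfl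
      · exact hNspec w hw hv b m h1
      · exact h0
  choose f hf using fun d => mem_ord_zero_iff.1
    (tpow_mul_mem_ord.2 (by simpa using hNspec f₀ hf₀ hv d) : tpow N * f₀ d ∈ ord 0)
  have hfv : VanishesBelow (j₀ : ℕ) f := by
    intro d hd
    have h1 := hf d
    rw [hv d hd, mul_zero] at h1
    exact (map_eq_zero_iff _ (FaithfulSMul.algebraMap_injective O F)).1 h1
  have hfb : PowerSeries.constantCoeff (f b) ≠ 0 := by
    have h3 := HahnSeries.coeff_single_mul_add (Γ := ℤ) (r := (1 : ℂ)) (x := f₀ b) (a := -N)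
      (b := N)
    rw [neg_add_cancel, one_mul, ← hf b] at h3
    rw [← PowerSeries.coeff_zero_eq_constantCoeff_apply, ← coeff_coe_nat]
    exact h3 ▸ hb
  obtain ⟨k, hk, hkf, hke⟩ := exists_mulVec_eq_single hfv hfb
  set M := L.map ((toSp k : MatF n).mulVecLin.restrictScalars O) with hM
  have hMd : dual M = M := dual_map (toSp k).2 (toSp_mul_inv k) (toSp_inv_mul k) hL
  have hMs : SplitsBelow j γ M := h.map hkf
  have hlow : ∀ w ∈ M, VanishesBelow j w → ∀ b, w b ∈ ord (-N) := by
    rintro _ ⟨w, hw, rfl⟩ hv b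
    refine mulVec_mem_ord fun d => ?_
    exact zero_add (-(N : ℤ)) ▸ mul_mem_ord (toSp_apply_mem_ord k b d)
      (hNspec w hw (fun c hc => (hkf.1 w c hc).symm.trans (hv c hc)) d)
  refine ⟨k, hk, Function.update γ j₀ N, fun i hi => ?_⟩
  by_cases hij : i = j₀
  · rw [hij, Function.update_self]
    refine ⟨⟨f₀, hf₀, ?_⟩, ?_, hlow⟩
    · have h1 : f₀ = tpow (-N) • fun d => algebraMap O F (f d) := by
        ext1 d
        rw [Pi.smul_apply, smul_eq_mul, hf, ← mul_assoc, tpow_neg_mul, one_mul]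
      have h2 : (toSp k : MatF n) *ᵥ (fun d => algebraMap O F (f d)) =
          Pi.single (Sum.inl j₀) 1 := by
        have h3 : (toSp k : MatF n) *ᵥ (fun d => algebraMap O F (f d)) =
            fun d => algebraMap O F (((k : MatO n) *ᵥ f) d) :=
          funext fun d => (RingHom.map_mulVec (algebraMap O F) (k : MatO n) f d).symm
        rw [h3, hke]
        ext1 d
        by_cases hd : d = Sum.inl j₀
        · rw [hd, Pi.single_eq_same, Pi.single_eq_same, map_one]
        · rw [Pi.single_eq_of_ne hd, Pi.single_eq_of_ne hd, map_zero]
      have h4 : (toSp k : MatF n) *ᵥ f₀ = Pi.single (Sum.inl j₀) (tpow (-N)) := by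
        rw [h1, Matrix.mulVec_smul, h2]
        ext1 d
        rw [Pi.smul_apply, smul_eq_mul, Pi.single_apply, Pi.single_apply]
        split_ifs
        · exact mul_one _
        · exact mul_zero _
      exact h4
    · change _ ∈ M
      rw [← hMd, mem_dual]
      intro w hw
      rw [corow_single_inr, Submodule.neg_mem_iff, tpow_mul_mem_ord, zero_sub,
        ← cut_apply (lt_irrefl j) w]
      exact hlow _ (hMs.cut_mem hMd hw) (vanishesBelow_cut _ _) _
  · rw [Function.update_of_ne hij]
    refine hMs i ?_
    have : (i : ℕ) ≠ j := fun h => hij (Fin.ext h)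
    omega

theorem SplitsBelow.exists_map (d : ℕ) : ∀ {j : ℕ} {γ : Fin n → ℕ} {L : Submodule O (VF n)},
    SplitsBelow j γ L → dual L = L → L.FG → j + d = n → ∃ k ∈ joinedGroup n, ∃ γ' : Fin n → ℕ,
      SplitsBelow n γ' (L.map ((toSp k : MatF n).mulVecLin.restrictScalars O)) := by
  induction d with
  | zero =>
    intro j γ L h hL hfg hj
    refine ⟨1, one_mem _, γ, ?_⟩
    have : L.map ((toSp (1 : symplecticGroup (Fin n) O) : MatF n).mulVecLin.restrictScalars O) = L
        := by
      have h1 : (toSp (1 : symplecticGroup (Fin n) O) : MatF n) = 1 := by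
        rw [map_one]
        rfl
      ext u
      rw [h1, mem_map_mulVec (h := 1) (mul_one _) (mul_one _), Matrix.one_mulVec]
    rw [this]
    exact (add_zero j ▸ hj) ▸ h
  | succ d ih =>
    intro j γ L h hL hfg hj
    obtain ⟨k, hk, γ', h'⟩ := h.exists_succ hL hfg (by omega)
    obtain ⟨l, hl, γ'', h''⟩ := ih h' (dual_map (toSp k).2 (toSp_mul_inv k) (toSp_inv_mul k) hL)
      (hfg.map _) (by omega)
    refine ⟨l * k, mul_mem hl hk, γ'', ?_⟩
    have : L.map ((toSp (l * k) : MatF n).mulVecLin.restrictScalars O) =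
        (L.map ((toSp k : MatF n).mulVecLin.restrictScalars O)).map
          ((toSp l : MatF n).mulVecLin.restrictScalars O) := by
      rw [← Submodule.map_comp, toSp_mul]
      congr 1
      exact LinearMap.ext fun u => (Matrix.mulVec_mulVec u _ _).symm
    rwa [this]

theorem SplitsBelow.antitone (h : SplitsBelow n γ L) : Antitone γ := by
  intro i i' hii
  have h1 := (h i i.2).2.2 _ (h i' i'.2).1 (fun d hd => by
    rw [Pi.single_eq_of_ne]
    rintro rfl
    exact absurd hd (not_lt.2 hii)) (Sum.inl i')
  rw [Pi.single_eq_same] at h1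
  by_contra hlt
  have h2 := h1 (-γ i') (by omega)
  simp at h2

theorem SplitsBelow.eq_lat (h : SplitsBelow n γ L) (hL : dual L = L) :
    L = lat (dia (odd fun i => (γ i : ℤ))) := by
  have hpos : ∀ b : Idx n, pos b < n := by
    rintro (b | b) <;> exact b.2
  ext w
  rw [mem_lat_dia]
  refine ⟨fun hw b => h.apply_mem_ord hL hw (hpos b), fun hw => ?_⟩
  have h1 : w = ∑ b, Pi.single b (w b) := (Finset.univ_sum_single w).symm
  rw [h1]
  exact L.sum_mem fun b _ => single_mem_of_mem_ord (h.single_mem (hpos b)) (hw b)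

/-- The Cartan decomposition for self-dual lattices. -/
theorem exists_eq_lat_frame (hL : dual L = L) (hfg : L.FG) :
    ∃ k ∈ joinedGroup n, ∃ γ : Fin n → ℕ, Antitone γ ∧
      L = lat (frame k (isOdd_odd fun i => (γ i : ℤ)) : MatF n) := by
  obtain ⟨k, hk, γ, h⟩ := SplitsBelow.exists_map n (j := 0) (γ := fun _ => 0) (L := L)
    (fun i hi => absurd hi (Nat.not_lt_zero _)) hL hfg (zero_add n)
  refine ⟨k⁻¹, inv_mem hk, γ, h.antitone, ?_⟩
  have h1 := h.eq_lat (dual_map (toSp k).2 (toSp_mul_inv k) (toSp_inv_mul k) hL)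
  rw [frame_coe, lat_mul, ← h1]
  ext u
  rw [mem_map_mulVec (toSp_inv_mul k) (toSp_mul_inv k),
    mem_map_mulVec (toSp_mul_inv k) (toSp_inv_mul k), Matrix.mulVec_mulVec, toSp_inv_mul,
    Matrix.one_mulVec]

end Cartan

/-! ### Self-dual bisignatures -/

section Bisignature

variable {n : ℕ}

/-- `lam` is nondecreasing and contracting as a function of the values of `c`. -/
def IsContraction (c lam : Idx n → ℤ) : Prop :=
  ∀ i j, c i ≤ c j → lam i ≤ lam j ∧ lam j - lam i ≤ c j - c i

/-- The sum of the two partitions of a bisignature, as an odd function on the index set. -/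
def total (θ ζ : Partition n) : Idx n → ℤ := odd fun i => ((θ.1 i + ζ.1 i : ℕ) : ℤ)

theorem isOdd_total (θ ζ : Partition n) : IsOdd (total θ ζ) := isOdd_odd _

theorem isOdd_selfDual (θ : Partition n) : IsOdd θ.selfDual := isOdd_odd _

theorem total_eq (θ ζ : Partition n) (i : Idx n) :
    total θ ζ i = θ.selfDual i + ζ.selfDual i := by
  rcases i with i | i
  · simp [total, odd, Partition.selfDual]
  · simp [total, odd, Partition.selfDual]
    ring

theorem isContraction_total (θ ζ : Partition n) : IsContraction (total θ ζ) θ.selfDual := by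
  have key : ∀ i j : Fin n, (θ.1 j ≤ θ.1 i ∧ ζ.1 j ≤ ζ.1 i) ∨ (θ.1 i ≤ θ.1 j ∧ ζ.1 i ≤ ζ.1 j) :=
    fun i j => (le_total i j).imp (fun h => ⟨θ.2 h, ζ.2 h⟩) fun h => ⟨θ.2 h, ζ.2 h⟩
  rintro (i | i) (j | j) h
  all_goals
    have := key i j
    simp only [total, odd, Partition.selfDual, Sum.elim_inl, Sum.elim_inr, Pi.neg_apply] at h ⊢
    push_cast at h ⊢
    omega

/-- The maximal solutions of the tropical inequalities that cut out the zero fiber of the moment map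
are the self-dual bisignatures. -/
theorem exists_bisignature {γ : Fin n → ℕ} (hγ : Antitone γ) {a : Idx n → ℤ}
    (ha : ∀ i j, a i + a j ≤ max 0 (odd (fun i => (γ i : ℤ)) i + odd (fun i => (γ i : ℤ)) j)) :
    ∃ θ ζ : Partition n, (∀ i, γ i = θ.1 i + ζ.1 i) ∧ a ≤ θ.selfDual := by
  set c : Idx n → ℤ := odd fun i => (γ i : ℤ) with hc
  have hodd : ∀ i, c (Sum.swap i) = -c i := isOdd_odd _
  set S : Set (Idx n → ℤ) := {b | a ≤ b ∧ ∀ i j, b i + b j ≤ max 0 (c i + c j)} with hS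
  have hfin : S.Finite := by
    refine (Set.finite_Icc a fun i => max 0 (c i)).subset fun b hb => ⟨hb.1, fun i => ?_⟩
    have := hb.2 i i
    dsimp only
    omega
  obtain ⟨b, hb⟩ := hfin.exists_maximal ⟨a, le_rfl, ha⟩
  obtain ⟨hab', hbc⟩ : a ≤ b ∧ ∀ i j, b i + b j ≤ max 0 (c i + c j) := hb.1
  have hab : ∀ i, a i ≤ b i := hab'
  have htight : ∀ i, ∃ j, b i + b j = max 0 (c i + c j) := by
    intro i
    by_contra! hne
    have hlt : ∀ j, b i + b j < max 0 (c i + c j) := fun j => lt_of_le_of_ne (hbc i j) (hne j)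
    have hmem : Function.update b i (b i + 1) ∈ S := by
      refine ⟨fun j => ?_, fun j l => ?_⟩
      · by_cases h : j = i
        · subst h
          rw [Function.update_self]
          exact (hab j).trans (Int.le_add_one le_rfl)
        · rw [Function.update_of_ne h]
          exact hab j
      · by_cases h : j = i <;> by_cases h' : l = i
        · subst h
          subst h'
          rw [Function.update_self]
          have := hlt l
          omega
        · subst h
          rw [Function.update_self, Function.update_of_ne h']
          have := hlt l
          omega
        · subst h'
          rw [Function.update_self, Function.update_of_ne h]
          have := hlt j
          rw [add_comm (c j)]
          omega
        · rw [Function.update_of_ne h, Function.update_of_ne h']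
          exact hbc j l
    have h1 : Function.update b i (b i + 1) i ≤ b i := hb.2 hmem (fun j => by
      by_cases h : j = i
      · subst h
        rw [Function.update_self]
        exact Int.le_add_one le_rfl
      · rw [Function.update_of_ne h]) i
    rw [Function.update_self] at h1
    exact absurd h1 (Int.not_le.2 (Int.lt_succ _))
  have hlip : ∀ i k, b k - b i ≤ max 0 (c k - c i) := by
    intro i k
    obtain ⟨j, hj⟩ := htight i
    have := hbc k j
    omega
  have hbodd : ∀ i, b (Sum.swap i) = -b i := by
    intro i
    obtain ⟨j, hj⟩ := htight i
    obtain ⟨k, hk⟩ := htight (Sum.swap i)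
    have h1 := hbc j k
    have h2 := hbc i (Sum.swap i)
    have h3 := hodd i
    omega
  have hinl : ∀ i : Fin n, c (Sum.inl i) = γ i := fun _ => rfl
  have hinr : ∀ i : Fin n, c (Sum.inr i) = -γ i := fun _ => rfl
  have hbinr : ∀ i : Fin n, b (Sum.inr i) = -b (Sum.inl i) := fun i => hbodd (Sum.inl i)
  have hbd : ∀ i : Fin n, 0 ≤ b (Sum.inl i) ∧ b (Sum.inl i) ≤ γ i := by
    intro i
    have h1 := hlip (Sum.inl i) (Sum.inr i)
    have h2 := hlip (Sum.inr i) (Sum.inl i)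
    rw [hbinr, hinl, hinr] at h1 h2
    omega
  have hmono : ∀ i j : Fin n, i ≤ j → b (Sum.inl j) ≤ b (Sum.inl i) ∧
      γ j - b (Sum.inl j) ≤ γ i - b (Sum.inl i) := by
    intro i j hij
    have h1 := hlip (Sum.inl i) (Sum.inl j)
    have h2 := hlip (Sum.inl j) (Sum.inl i)
    have h3 := hγ hij
    rw [hinl, hinl] at h1 h2
    omega
  refine ⟨⟨fun i => (b (Sum.inl i)).toNat, fun i j hij => ?_⟩,
    ⟨fun i => (γ i - b (Sum.inl i)).toNat, fun i j hij => ?_⟩, fun i => ?_, ?_⟩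
  · have := hmono i j hij
    dsimp only
    omega
  · have := hmono i j hij
    dsimp only
    omega
  · have := hbd i
    dsimp only
    omega
  · rintro (i | i)
    · have h1 := hbd i
      have h2 := hab (Sum.inl i)
      change a (Sum.inl i) ≤ ((b (Sum.inl i)).toNat : ℤ)
      omega
    · have h1 := hbd i
      have h2 := hab (Sum.inr i)
      rw [hbinr] at h2
      change a (Sum.inr i) ≤ -((b (Sum.inl i)).toNat : ℤ)
      omega

theorem le_of_perm {γ γ' : Fin n → ℕ} (hγ : Antitone γ) (hγ' : Antitone γ')
    (π : Equiv.Perm (Idx n))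
    (h : ∀ i, odd (fun i => (γ i : ℤ)) i ≤ odd (fun i => (γ' i : ℤ)) (π i)) : γ ≤ γ' := by
  intro i
  by_contra! hlt'
  have hlt : γ' i < γ i := hlt'
  have hsub : (Finset.Iic i).image (fun l => π (Sum.inl l)) ⊆ (Finset.Iio i).image Sum.inl := by
    intro b hb
    obtain ⟨l, hl, rfl⟩ := Finset.mem_image.1 hb
    have h1 := h (Sum.inl l)
    have h2 : γ i ≤ γ l := hγ (Finset.mem_Iic.1 hl)
    rcases hb' : π (Sum.inl l) with l' | l'
    · refine Finset.mem_image.2 ⟨l', Finset.mem_Iio.2 ?_, rfl⟩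
      by_contra! h3
      have h4 : γ' l' ≤ γ' i := hγ' h3
      simp only [hb', odd, Sum.elim_inl] at h1
      omega
    · simp only [hb', odd, Sum.elim_inl, Sum.elim_inr, Pi.neg_apply] at h1
      omega
  have hcard := Finset.card_le_card hsub
  rw [Finset.card_image_of_injective (Finset.Iic i) (f := fun l => π (Sum.inl l))
    (π.injective.comp Sum.inl_injective),
    Finset.card_image_of_injective _ Sum.inl_injective, Fin.card_Iic, Fin.card_Iio] at hcard
  omega

/-- An integral invertible matrix that carries `t^{-c} V_𝐎` into `t^{-c'} V_𝐎` exists only if `c` is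
dominated by `c'`. -/
theorem le_of_apply_mem_ord {γ γ' : Fin n → ℕ} (hγ : Antitone γ) (hγ' : Antitone γ')
    {m : MatO n} (hm : IsUnit m) (h : ∀ i j, algebraMap O F (m i j) ∈
      ord (odd (fun i => (γ i : ℤ)) j - odd (fun i => (γ' i : ℤ)) i)) : γ ≤ γ' := by
  have hdet : (m.map (PowerSeries.constantCoeff (R := ℂ))).det ≠ 0 := by
    rw [← RingHom.mapMatrix_apply, ← RingHom.map_det]
    exact (((Matrix.isUnit_iff_isUnit_det m).1 hm).map _).ne_zero
  rw [Matrix.det_apply] at hdet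
  obtain ⟨π, -, hπ⟩ := Finset.exists_ne_zero_of_sum_ne_zero hdet
  refine le_of_perm hγ hγ' π fun i => ?_
  have hi : PowerSeries.constantCoeff (m (π i) i) ≠ 0 := by
    intro h0
    exact hπ (by rw [Finset.prod_eq_zero (Finset.mem_univ i) h0, smul_zero])
  by_contra! hlt
  refine hi ?_
  rw [← PowerSeries.coeff_zero_eq_constantCoeff_apply, ← coeff_coe_nat]
  exact h (π i) i _ (by simpa using hlt)

end Bisignature

/-! ### The strata of the zero fiber -/

section Stratum

variable {n : ℕ}

theorem mem_sp_iff_blocks {R : Type} [CommRing R]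
    {x : Matrix (Idx n) (Idx n) R} : x ∈ LieAlgebra.Symplectic.sp (Fin n) R ↔
    (∀ i k, x (Sum.inr k) (Sum.inl i) = x (Sum.inr i) (Sum.inl k)) ∧
    (∀ i k, x (Sum.inl k) (Sum.inr i) = x (Sum.inl i) (Sum.inr k)) ∧
    ∀ i k, x (Sum.inr i) (Sum.inr k) = -x (Sum.inl k) (Sum.inl i) := by
  have h1 : ∀ (y : Matrix (Idx n) (Idx n) R) (i : Idx n) (k : Fin n),
      (y * J (Fin n) R) i (Sum.inl k) = y i (Sum.inr k) := by
    intro y i k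
    simp [Matrix.mul_apply, J, Matrix.one_apply]
  have h2 : ∀ (y : Matrix (Idx n) (Idx n) R) (i : Idx n) (k : Fin n),
      (y * J (Fin n) R) i (Sum.inr k) = -y i (Sum.inl k) := by
    intro y i k
    simp [Matrix.mul_apply, J, Matrix.one_apply]
  have h3 : ∀ (y : Matrix (Idx n) (Idx n) R) (i : Fin n) (k : Idx n),
      (J (Fin n) R * y) (Sum.inl i) k = -y (Sum.inr i) k := by
    intro y i k
    simp [Matrix.mul_apply, J, Matrix.one_apply]
  have h4 : ∀ (y : Matrix (Idx n) (Idx n) R) (i : Fin n) (k : Idx n),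
      (J (Fin n) R * y) (Sum.inr i) k = y (Sum.inl i) k := by
    intro y i k
    simp [Matrix.mul_apply, J, Matrix.one_apply]
  rw [mem_sp_matrix]
  constructor
  · intro h
    have h' := fun i k => congrFun (congrFun h i) k
    refine ⟨fun i k => ?_, fun i k => ?_, fun i k => ?_⟩
    · have := h' (Sum.inl i) (Sum.inl k)
      rw [h1, h3, transpose_apply, Matrix.neg_apply, neg_neg] at this
      exact this
    · have := h' (Sum.inr i) (Sum.inr k)
      rw [h2, h4, transpose_apply, Matrix.neg_apply, neg_inj] at this
      exact this
    · have := h' (Sum.inl i) (Sum.inr k)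
      rw [h2, h3, transpose_apply, Matrix.neg_apply, neg_neg] at this
      exact this.symm
  · rintro ⟨ha, hb, hc⟩
    ext1 i k
    rcases i with i | i <;> rcases k with k | k
    · rw [h1, h3, transpose_apply, Matrix.neg_apply, neg_neg, ha]
    · rw [h2, h3, transpose_apply, Matrix.neg_apply, neg_neg, hc]
    · rw [h1, h4, transpose_apply, Matrix.neg_apply, hc]
    · rw [h2, h4, transpose_apply, Matrix.neg_apply, hb]

theorem momMat_apply (v : VF n) (x : MatF n) (i j : Idx n) :
    momMat v x i j = x i j + tpow 1 * (v i * corow v j) := rfl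

/-- The entries of a matrix that lower the value of `c`. -/
def truncate (c : Idx n → ℤ) (x : MatF n) : MatF n := fun i j => if c j < c i then x i j else 0

theorem truncate_mem_sp {c : Idx n → ℤ} (hc : IsOdd c) {x : MatF n}
    (hx : x ∈ LieAlgebra.Symplectic.sp (Fin n) F) :
    truncate c x ∈ LieAlgebra.Symplectic.sp (Fin n) F := by
  rw [mem_sp_iff_blocks] at hx ⊢
  obtain ⟨h1, h2, h3⟩ := hx
  have hr : ∀ i : Fin n, c (Sum.inr i) = -c (Sum.inl i) := fun i => hc (Sum.inl i)
  refine ⟨fun i k => ?_, fun i k => ?_, fun i k => ?_⟩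
  · simp only [truncate, h1 i k, hr]
    exact if_congr (by omega) rfl rfl
  · simp only [truncate, h2 i k, hr]
    exact if_congr (by omega) rfl rfl
  · simp only [truncate, h3 i k, hr]
    have h4 : -c (Sum.inl k) < -c (Sum.inl i) ↔ c (Sum.inl i) < c (Sum.inl k) := by omega
    rw [if_congr h4 rfl rfl]
    split_ifs
    · rfl
    · exact neg_zero.symm

/-- A covector at `(v, t^{-c} V_𝐎)` in the zero fiber of the moment map. -/
def baseCovector (c : Idx n → ℤ) (v : VF n) : MatF n := -truncate c (momMat v 0)

theorem baseCovector_mem_sp {c : Idx n → ℤ} (hc : IsOdd c) (v : VF n) :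
    baseCovector c v ∈ LieAlgebra.Symplectic.sp (Fin n) F :=
  neg_mem (truncate_mem_sp hc (addSq_mem_sp _ _ (zero_mem _)))

theorem corow_mem_ord {lam : Idx n → ℤ} (hl : IsOdd lam) {v : VF n} (hv : ∀ i, v i ∈ ord (-lam i))
    (j : Idx n) : corow v j ∈ ord (lam j) := by
  rcases j with j | j
  · have := (ord _).neg_mem (hv (Sum.inr j))
    rwa [show -lam (Sum.inr j) = lam (Sum.inl j) by rw [← hl]; rfl] at this
  · have := hv (Sum.inl j)
    rwa [show -lam (Sum.inl j) = lam (Sum.inr j) by rw [← hl]; rfl] at this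

theorem momMat_zero_mem_ord {lam : Idx n → ℤ} (hl : IsOdd lam) {v : VF n}
    (hv : ∀ i, v i ∈ ord (-lam i)) (i j : Idx n) :
    momMat v 0 i j ∈ ord (1 + (lam j - lam i)) := by
  rw [momMat_apply, Matrix.zero_apply, zero_add, tpow_mul_mem_ord]
  have := mul_mem_ord (hv i) (corow_mem_ord hl hv j)
  convert this using 2
  ring

theorem baseCovector_mem_ord {c lam : Idx n → ℤ} (hl : IsOdd lam) (hcl : IsContraction c lam)
    {v : VF n} (hv : ∀ i, v i ∈ ord (-lam i)) (i j : Idx n) :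
    baseCovector c v i j ∈ ord (1 + c j - c i) := by
  refine (ord _).neg_mem ?_
  rw [truncate]
  split_ifs with h
  · have := (hcl j i h.le).2
    exact ord_anti (by omega) (momMat_zero_mem_ord hl hv i j)
  · exact Submodule.zero_mem _

theorem momMat_baseCovector_mem_ord {c lam : Idx n → ℤ} (hl : IsOdd lam)
    (hcl : IsContraction c lam) {v : VF n} (hv : ∀ i, v i ∈ ord (-lam i)) (i j : Idx n) :
    momMat v (baseCovector c v) i j ∈ ord 1 := by
  have h1 : momMat v (baseCovector c v) i j =
      momMat v 0 i j - if c j < c i then momMat v 0 i j else 0 := by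
    have : momMat v 0 i j = tpow 1 * (v i * corow v j) := zero_add _
    rw [momMat_apply, this, sub_eq_add_neg, add_comm, ← this]
    rfl
  rw [h1]
  split_ifs with h
  · rw [sub_self]
    exact Submodule.zero_mem _
  · have := (hcl i j (not_lt.1 h)).1
    rw [sub_zero]
    exact ord_anti (by omega) (momMat_zero_mem_ord hl hv i j)

/-- The points of the zero fiber which an integral symplectic matrix joined to the identity carries
to a point `(v, t^{-c} V_𝐎, x)` with `v ∈ t^{-lam} V_𝐎`. -/
def stratum {c : Idx n → ℤ} (hc : IsOdd c) (lam : Idx n → ℤ) : Set (SpCot n) :=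
  {p | p ∈ zeroFiber n ∧ ∃ k ∈ joinedGroup n, ∃ (v : VF n) (x : MatF n)
    (hx : x ∈ LieAlgebra.Symplectic.sp (Fin n) F) (hn : ∀ i j, x i j ∈ ord (1 + c j - c i)),
    (∀ i, v i ∈ ord (-lam i)) ∧ p = pt k hc v hx hn}

/-- The framed point given by the obvious frame of `k t^{-c} V_𝐎`. -/
def framedPt (k : symplecticGroup (Fin n) O) {c : Idx n → ℤ} (hc : IsOdd c) (v : VF n) {x : MatF n}
    (hx : x ∈ LieAlgebra.Symplectic.sp (Fin n) F) (hn : ∀ i j, x i j ∈ ord (1 + c j - c i)) :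
    Framed n := ⟨(pt k hc v hx hn, frame k hc), rfl⟩

theorem framedPt_coords_mem {k : ℂ → symplecticGroup (Fin n) O} {c : Idx n → ℤ} (hc : IsOdd c)
    {v : ℂ → VF n} {x : ℂ → MatF n} (hx : ∀ s, x s ∈ LieAlgebra.Symplectic.sp (Fin n) F)
    (hn : ∀ s i j, x s i j ∈ ord (1 + c j - c i))
    (hk : IsMatFam polyFun fun s => (toSp (k s) : MatF n))
    (hv : ∀ i, (fun s => v s i) ∈ laurentFam polyFun) (hxf : IsMatFam polyFun x) (a : Crd n) :
    (fun s => (framedPt (k s) hc (v s) (hx s) (hn s)).coords a) ∈ laurentFam polyFun := by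
  have hk' : IsMatFam polyFun fun s => (toSp (k s)⁻¹ : MatF n) := by
    simpa only [toSp_inv] using
      ((IsMatFam.const (-J (Fin n) F)).mul hk.transpose).mul (IsMatFam.const (J (Fin n) F))
  rcases a with i | ⟨i, j⟩ | ⟨i, j⟩
  · exact hk.mulVec hv i
  · exact hk.mul (IsMatFam.const (dia c)) i j
  · exact (hk.mul hxf).mul hk' i j

/-- The segment between two Laurent series. -/
def seg (f g : F) (s : ℂ) : F := HahnSeries.C (1 - s) * f + HahnSeries.C s * g

theorem seg_zero (f g : F) : seg f g 0 = f := by simp [seg]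

theorem seg_one (f g : F) : seg f g 1 = g := by simp [seg]

theorem C_mul_mem_ord (a : ℂ) {m : ℤ} {f : F} (hf : f ∈ ord m) :
    (HahnSeries.C a : F) * f ∈ ord m :=
  zero_add m ▸ mul_mem_ord (fun _ hj => HahnSeries.coeff_single_of_ne hj.ne) hf

theorem seg_mem_ord {m : ℤ} {f g : F} (hf : f ∈ ord m) (hg : g ∈ ord m) (s : ℂ) :
    seg f g s ∈ ord m := (ord m).add_mem (C_mul_mem_ord _ hf) (C_mul_mem_ord _ hg)

theorem seg_coeff (f g : F) (s : ℂ) (m : ℤ) :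
    (seg f g s).coeff m = (1 - s) * f.coeff m + s * g.coeff m := by
  rw [seg, HahnSeries.coeff_add, HahnSeries.C_mul_eq_smul, HahnSeries.C_mul_eq_smul]
  rfl

theorem seg_mem_laurentFam (f g : F) : seg f g ∈ laurentFam polyFun :=
  add_mem (mul_mem (laurentFam_C ⟨1 - Polynomial.X, fun s => by simp⟩) (laurentFam_const _ f))
    (mul_mem (laurentFam_C ⟨Polynomial.X, fun s => by simp⟩) (laurentFam_const _ g))

theorem baseCovector_fam {c : Idx n → ℤ} {v : ℂ → VF n}
    (hv : ∀ i, (fun s => v s i) ∈ laurentFam polyFun) :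
    IsMatFam polyFun fun s => baseCovector c (v s) := by
  intro i j
  refine neg_mem (s := laurentFam polyFun) (x := fun s => truncate c (momMat (v s) 0) i j) ?_
  by_cases h : c j < c i
  · have h1 : (fun s => truncate c (momMat (v s) 0) i j) =
        (fun _ => tpow 1) * ((fun s => v s i) * fun s => corow (v s) j) := by
      ext1 s
      exact (if_pos h).trans (zero_add _)
    rw [h1]
    refine mul_mem (laurentFam_const _ _) (mul_mem (hv i) ?_)
    rcases j with j | j
    · exact neg_mem (hv (Sum.inr j))
    · exact hv (Sum.inl j)
  · have h1 : (fun s => truncate c (momMat (v s) 0) i j) = 0 := by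
      ext1 s
      exact if_neg h
    rw [h1]
    exact zero_mem _

/-- Two points of a stratum are joined by a curve in it. -/
theorem exists_curve {c lam : Idx n → ℤ} (hc : IsOdd c) (hl : IsOdd lam)
    (hcl : IsContraction c lam) {p q : SpCot n} (hp : p ∈ zeroFiber n) (hq : q ∈ zeroFiber n)
    {k l : symplecticGroup (Fin n) O} (hk : k ∈ joinedGroup n) (hl' : l ∈ joinedGroup n)
    {v w : VF n} {x y : MatF n} {hx : x ∈ LieAlgebra.Symplectic.sp (Fin n) F}
    {hn : ∀ i j, x i j ∈ ord (1 + c j - c i)} {hy : y ∈ LieAlgebra.Symplectic.sp (Fin n) F}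
    {hm : ∀ i j, y i j ∈ ord (1 + c j - c i)} (hv : ∀ i, v i ∈ ord (-lam i))
    (hw : ∀ i, w i ∈ ord (-lam i)) (hpk : p = pt k hc v hx hn) (hql : q = pt l hc w hy hm) :
    ∃ φ : ℂ → Framed n, (∀ a, (fun s => (φ s).coords a) ∈ laurentFam polyFun) ∧
      (φ 0).1.1 = p ∧ (φ 1).1.1 = q ∧ ∀ s, (φ s).1.1 ∈ zeroFiber n ∧
        ∃ m ∈ joinedGroup n, ∃ (z : MatF n) (hz : z ∈ LieAlgebra.Symplectic.sp (Fin n) F)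
          (hzn : ∀ i j, z i j ∈ ord (1 + c j - c i)),
          (φ s).1.1 = pt m hc (fun i => seg (v i) (w i) s) hz hzn := by
  obtain ⟨h, h0, rfl, hh⟩ := hk
  obtain ⟨g, g0, rfl, hg⟩ := hl'
  set k : ℂ → symplecticGroup (Fin n) O := fun s => h (1 - s) * g s with hkdef
  have hkfam : IsMatFam polyFun fun s => (toSp (k s) : MatF n) := by
    have h1 : IsMatFam polyFun fun s => (toSp (h (1 - s)) : MatF n) := fun i j => by
      have := laurentFam_polyFun_comp (hh i j) (1 - Polynomial.X)
      simpa only [Polynomial.eval_sub, Polynomial.eval_one, Polynomial.eval_X] using this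
    simpa only [hkdef, toSp_mul] using h1.mul hg
  set u : ℂ → VF n := fun s i => seg (v i) (w i) s with hu
  have hufam : ∀ i, (fun s => u s i) ∈ laurentFam polyFun := fun i => seg_mem_laurentFam _ _
  have humem : ∀ s i, u s i ∈ ord (-lam i) := fun s i => seg_mem_ord (hv i) (hw i) s
  set x' : MatF n := x - baseCovector c v with hx'
  set y' : MatF n := y - baseCovector c w with hy'
  have hx's : x' ∈ LieAlgebra.Symplectic.sp (Fin n) F := sub_mem hx (baseCovector_mem_sp hc v)
  have hy's : y' ∈ LieAlgebra.Symplectic.sp (Fin n) F := sub_mem hy (baseCovector_mem_sp hc w)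
  set z : ℂ → MatF n := fun s => baseCovector c (u s) +
    Matrix.of fun i j => seg (x' i j) (y' i j) s with hz
  have hzs : ∀ s, z s ∈ LieAlgebra.Symplectic.sp (Fin n) F := by
    intro s
    refine add_mem (baseCovector_mem_sp hc _) ?_
    rw [mem_sp_iff_blocks] at hx's hy's ⊢
    obtain ⟨h1, h2, h3⟩ := hx's
    obtain ⟨h4, h5, h6⟩ := hy's
    refine ⟨fun i k => ?_, fun i k => ?_, fun i k => ?_⟩
    · simp only [Matrix.of_apply, h1 i k, h4 i k]
    · simp only [Matrix.of_apply, h2 i k, h5 i k]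
    · simp only [Matrix.of_apply, h3 i k, h6 i k, seg]
      ring
  have hzn : ∀ s i j, z s i j ∈ ord (1 + c j - c i) := fun s i j =>
    (ord _).add_mem (baseCovector_mem_ord hl hcl (humem s) i j) (seg_mem_ord
      ((ord _).sub_mem (hn i j) (baseCovector_mem_ord hl hcl hv i j))
      ((ord _).sub_mem (hm i j) (baseCovector_mem_ord hl hcl hw i j)) s)
  have hzfam : IsMatFam polyFun z := fun i j =>
    add_mem (baseCovector_fam hufam i j) (seg_mem_laurentFam _ _)
  have hsub : ∀ (v : VF n) (x : MatF n), (∀ i, v i ∈ ord (-lam i)) →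
      (∀ i j, momMat v x i j ∈ ord 1) → ∀ i j, (x - baseCovector c v) i j ∈ ord 1 := by
    intro v x hv hx i j
    have h1 := (ord 1).sub_mem (hx i j) (momMat_baseCovector_mem_ord hl hcl hv i j)
    rwa [momMat_apply, momMat_apply, add_sub_add_right_eq_sub] at h1
  have hx'1 := hsub v x hv (pt_mem_zeroFiber_iff.1 (hpk ▸ hp))
  have hy'1 := hsub w y hw (pt_mem_zeroFiber_iff.1 (hql ▸ hq))
  refine ⟨fun s => framedPt (k s) hc (u s) (hzs s) (hzn s),
    framedPt_coords_mem hc hzs hzn hkfam hufam hzfam, ?_, ?_, fun s => ⟨?_, k s, ?_, z s, hzs s,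
      hzn s, rfl⟩⟩
  · rw [hpk]
    have h1 : k 0 = h 1 := by simp only [hkdef, sub_zero, g0, mul_one]
    have h2 : u 0 = v := funext fun i => seg_zero _ _
    have h3 : z 0 = x := by
      ext1 i j
      simp only [hz, Matrix.add_apply, Matrix.of_apply, seg_zero, h2, hx', Matrix.sub_apply,
        add_sub_cancel]
    simp only [framedPt, h1, h2, h3]
  · rw [hql]
    have h1 : k 1 = g 1 := by simp only [hkdef, sub_self, h0, one_mul]
    have h2 : u 1 = w := funext fun i => seg_one _ _
    have h3 : z 1 = y := by
      ext1 i j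
      simp only [hz, Matrix.add_apply, Matrix.of_apply, seg_one, h2, hy', Matrix.sub_apply,
        add_sub_cancel]
    simp only [framedPt, h1, h2, h3]
  · refine (pt_mem_zeroFiber_iff (hx := hzs s) (hn := hzn s)).2 fun i j => ?_
    have h1 : momMat (u s) (z s) i j = momMat (u s) (baseCovector c (u s)) i j +
        seg (x' i j) (y' i j) s := by
      rw [momMat_apply, momMat_apply, add_right_comm]
      rfl
    rw [h1]
    exact (ord 1).add_mem (momMat_baseCovector_mem_ord hl hcl (humem s) i j)
      (seg_mem_ord (hx'1 i j) (hy'1 i j) s)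
  · refine mul_mem ?_ (curve_mem_joinedGroup g0 hg s)
    exact curve_mem_joinedGroup h0 hh (1 - s)

theorem isPreirreducible_stratum {c lam : Idx n → ℤ} (hc : IsOdd c) (hl : IsOdd lam)
    (hcl : IsContraction c lam) : IsPreirreducible (stratum hc lam) := by
  refine isPreirreducible_of_curves ?_
  rintro p ⟨hp, k, hk, v, x, hx, hn, hv, hpk⟩ q ⟨hq, l, hl', w, y, hy, hm, hw, hql⟩
  obtain ⟨φ, hφ, h0, h1, h2⟩ := exists_curve hc hl hcl hp hq hk hl' hv hw hpk hql
  refine ⟨φ, hφ, fun s => ?_, h0, h1⟩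
  obtain ⟨h3, m, hm, z, hz, hzn, h4⟩ := h2 s
  exact ⟨h3, m, hm, _, z, hz, hzn, fun i => seg_mem_ord (hv i) (hw i) s, h4⟩

end Stratum

/-! ### Conormal bundles and strata -/

section Conormal

variable {n : ℕ}

/-- The `σ`-fixed points of the conormal bundle to the orbit of a self-dual bisignature. -/
def fixedConormal (θ ζ : Partition n) : Set (SpCot n) :=
  {p | p.toGL ∈ conormal (bisignatureOrbit θ.selfDual ζ.selfDual) ∧ sigma p.toGL = p.toGL}

theorem mem_fixedConormal_iff {θ ζ : Partition n} {p : SpCot n} :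
    p ∈ fixedConormal θ ζ ↔
      (p.v, p.L) ∈ bisignatureOrbit θ.selfDual ζ.selfDual ∧ p ∈ zeroFiber n := by
  constructor
  · rintro ⟨⟨-, h1, h2⟩, -⟩
    exact ⟨h1, fun X => h2 X.1⟩
  · rintro ⟨h1, h2⟩
    obtain ⟨h3, h4⟩ := (sigma_fixed_iff _).2 ⟨p, rfl⟩
    exact ⟨⟨h3, h1, pair_eq_zero (mem_zeroFiber_iff.1 h2)⟩, h4⟩

theorem diagonal_eq_dia (θ ζ : Partition n) :
    (Matrix.diagonal fun i => HahnSeries.single (-θ.selfDual i - ζ.selfDual i) (1 : ℂ) : MatF n) =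
      dia (total θ ζ) := by
  rw [dia]
  congr 1
  ext1 i
  rw [total_eq, neg_add']

theorem toF_mul (k l : MatO n) : toF (k * l) = toF k * toF l := Matrix.map_mul

theorem toF_one : toF (1 : MatO n) = 1 := Matrix.map_one _ (map_zero _) (map_one _)

theorem toF_mul_inv (k : (MatO n)ˣ) : toF k.1 * toF (k⁻¹).1 = 1 := by
  rw [← toF_mul, Units.mul_inv, toF_one]

theorem toF_inv_mul (k : (MatO n)ˣ) : toF (k⁻¹).1 * toF k.1 = 1 := by
  rw [← toF_mul, Units.inv_mul, toF_one]

/-- An integral symplectic matrix as a unit of the ring of integral matrices. -/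
def unitOfSp (k : symplecticGroup (Fin n) O) : (MatO n)ˣ where
  val := k
  inv := (k⁻¹ : symplecticGroup (Fin n) O)
  val_inv := coe_mul_inv k
  inv_val := coe_inv_mul k

/-- A diagonal matrix of units. -/
def unitDiagonal (u : Idx n → Oˣ) : (MatO n)ˣ where
  val := Matrix.diagonal fun i => (u i : O)
  inv := Matrix.diagonal fun i => ((u i)⁻¹ : Oˣ)
  val_inv := by simp
  inv_val := by simp

theorem toF_unitDiagonal_mulVec (u : Idx n → Oˣ) (w : VF n) (i : Idx n) :
    (toF (unitDiagonal u).1 *ᵥ w) i = algebraMap O F (u i) * w i := by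
  have : toF (unitDiagonal u).1 = Matrix.diagonal fun i => algebraMap O F (u i) :=
    Matrix.diagonal_map (map_zero _)
  rw [this, Matrix.mulVec_diagonal]

theorem coe_mul_mem_ord (a : O) {m : ℤ} {f : F} (hf : f ∈ ord m) : algebraMap O F a * f ∈ ord m :=
  zero_add m ▸ mul_mem_ord (coe_mem_ord a) hf

theorem map_unitDiagonal_lat_dia (u : Idx n → Oˣ) (c : Idx n → ℤ) :
    (lat (dia c)).map ((toF (unitDiagonal u).1).mulVecLin.restrictScalars O) = lat (dia c) := by
  have hinv : (unitDiagonal u)⁻¹ = unitDiagonal fun i => (u i)⁻¹ := rfl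
  ext w
  rw [mem_map_mulVec (toF_mul_inv _) (toF_inv_mul _), mem_lat_dia, mem_lat_dia, hinv]
  refine forall_congr' fun i => ?_
  rw [toF_unitDiagonal_mulVec]
  refine ⟨fun h => ?_, fun h => coe_mul_mem_ord _ h⟩
  have := coe_mul_mem_ord (u i : O) h
  rwa [← mul_assoc, ← map_mul, Units.mul_inv, map_one, one_mul] at this

theorem pt_mem_fixedConormal {θ ζ : Partition n} {k : symplecticGroup (Fin n) O} {v : VF n}
    {x : MatF n} {hx : x ∈ LieAlgebra.Symplectic.sp (Fin n) F}
    {hn : ∀ i j, x i j ∈ ord (1 + total θ ζ j - total θ ζ i)}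
    (hp : pt k (isOdd_total θ ζ) v hx hn ∈ zeroFiber n)
    (hv : ∀ i, v i ∈ ord (-θ.selfDual i)) (hv' : ∀ i, (v i).coeff (-θ.selfDual i) ≠ 0) :
    pt k (isOdd_total θ ζ) v hx hn ∈ fixedConormal θ ζ := by
  refine mem_fixedConormal_iff.2 ⟨?_, hp⟩
  choose u hu using fun i => exists_unit_of_coeff_ne (hv i) (hv' i)
  refine ⟨unitOfSp k * unitDiagonal u, ?_, ?_⟩
  · have h1 : toF (unitDiagonal u).1 *ᵥ (fun i => tpow (-θ.selfDual i)) = v :=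
      funext fun i => (toF_unitDiagonal_mulVec _ _ i).trans (hu i).symm
    have h2 : toF (unitOfSp k * unitDiagonal u).1 = (toSp k : MatF n) * toF (unitDiagonal u).1 :=
      toF_mul _ _
    rw [h2, ← Matrix.mulVec_mulVec, h1]
    rfl
  · have h2 : toF (unitOfSp k * unitDiagonal u).1 = (toSp k : MatF n) * toF (unitDiagonal u).1 :=
      toF_mul _ _
    rw [h2, diagonal_eq_dia]
    change lat (frame k _ : MatF n) = _
    conv_lhs => rw [frame_coe, lat_mul, ← map_unitDiagonal_lat_dia u, ← Submodule.map_comp]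
    congr 1
    exact LinearMap.ext fun w =>
      Matrix.mulVec_mulVec w (toSp k : MatF n) (toF (unitDiagonal u).1)

theorem stratum_subset_closure (θ ζ : Partition n) :
    stratum (isOdd_total θ ζ) θ.selfDual ⊆ closure (fixedConormal θ ζ) := by
  rintro p ⟨hp, k, hk, v, x, hx, hn, hv, hpk⟩
  have hl := isOdd_selfDual θ
  have hcl := isContraction_total θ ζ
  set w : VF n := fun i => tpow (-θ.selfDual i) with hw
  have hwm : ∀ i, w i ∈ ord (-θ.selfDual i) := fun i => tpow_mem_ord _
  have hq := (pt_mem_zeroFiber_iff (k := 1) (hc := isOdd_total θ ζ)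
    (hx := baseCovector_mem_sp (isOdd_total θ ζ) w)
    (hn := baseCovector_mem_ord hl hcl hwm)).2 (momMat_baseCovector_mem_ord hl hcl hwm)
  obtain ⟨φ, hφ, h0, -, h2⟩ := exists_curve (isOdd_total θ ζ) hl hcl hp hq hk (one_mem _) hv hwm
    hpk rfl
  rw [← h0]
  refine mem_closure_of_curve φ hφ ?_ 0
  have hfin : (⋃ i, {s : ℂ | (1 - s) * (v i).coeff (-θ.selfDual i) + s = 0}).Finite := by
    refine Set.finite_iUnion fun i => Set.Subsingleton.finite fun s hs r hr => ?_
    have hs' : (1 - s) * (v i).coeff (-θ.selfDual i) + s = 0 := hs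
    have hr' : (1 - r) * (v i).coeff (-θ.selfDual i) + r = 0 := hr
    generalize (v i).coeff (-θ.selfDual i) = a at hs' hr'
    have h3 : (s - r) * (1 - a) = 0 := by linear_combination hs' - hr'
    rcases mul_eq_zero.1 h3 with h | h
    · exact sub_eq_zero.1 h
    · rw [← sub_eq_zero.1 h] at hs'
      simp at hs'
  refine hfin.subset fun s hs => ?_
  by_contra hns
  refine hs ?_
  obtain ⟨h3, m, hm, z, hz, hzn, h4⟩ := h2 s
  rw [h4]
  refine pt_mem_fixedConormal (h4 ▸ h3) (fun i => seg_mem_ord (hv i) (hwm i) s) fun i h5 => ?_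
  rw [seg_coeff, hw, HahnSeries.coeff_single_same, mul_one] at h5
  exact hns (Set.mem_iUnion.2 ⟨i, h5⟩)

theorem toF_apply_mem_ord_of_map_le {m : MatO n} {c c' : Idx n → ℤ}
    (h : ∀ w ∈ lat (dia c), toF m *ᵥ w ∈ lat (dia c')) (i j : Idx n) :
    algebraMap O F (m i j) ∈ ord (c j - c' i) := by
  have h1 := mem_lat_dia.1 (h _ (single_mem_lat_dia c j)) i
  rw [Matrix.mulVec_single, Pi.smul_apply, Matrix.col_apply, op_smul_eq_mul, mul_comm,
    tpow_mul_mem_ord] at h1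
  rw [show c j - c' i = -c' i - -c j by ring]
  exact h1

theorem fixedConormal_subset_stratum (θ ζ : Partition n) :
    fixedConormal θ ζ ⊆ stratum (isOdd_total θ ζ) θ.selfDual := by
  intro p hp
  obtain ⟨⟨g, hgv, hgL⟩, hp0⟩ := mem_fixedConormal_iff.1 hp
  rw [diagonal_eq_dia] at hgL
  obtain ⟨k, hk, γ, hγ, hL⟩ := exists_eq_lat_frame p.selfDual p.isLattice.fg
  have hγ' : Antitone fun i => θ.1 i + ζ.1 i := fun i j hij => add_le_add (θ.2 hij) (ζ.2 hij)
  set m : (MatO n)ˣ := (unitOfSp k)⁻¹ * g with hm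
  have hmF : toF m.1 = (toSp k⁻¹ : MatF n) * toF g.1 := toF_mul _ _
  have hmF' : toF (m⁻¹).1 = toF (g⁻¹).1 * (toSp k : MatF n) := by
    rw [hm, _root_.mul_inv_rev, inv_inv]
    exact toF_mul _ _
  have hmem1 : ∀ u, u ∈ p.L ↔ (toSp k⁻¹ : MatF n) *ᵥ u ∈ lat (dia (odd fun i => (γ i : ℤ))) := by
    intro u
    rw [hL, frame_coe, lat_mul, mem_map_mulVec (toSp_mul_inv k) (toSp_inv_mul k)]
  have hmem2 : ∀ u, u ∈ p.L ↔ toF (g⁻¹).1 *ᵥ u ∈ lat (dia (total θ ζ)) := by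
    intro u
    rw [show p.L = _ from hgL, mem_map_mulVec (toF_mul_inv g) (toF_inv_mul g)]
  have h1 : ∀ w ∈ lat (dia (total θ ζ)), toF m.1 *ᵥ w ∈ lat (dia (odd fun i => (γ i : ℤ))) := by
    intro w hw
    rw [hmF, ← Matrix.mulVec_mulVec, ← hmem1, hmem2, Matrix.mulVec_mulVec, toF_inv_mul,
      Matrix.one_mulVec]
    exact hw
  have h2 : ∀ w ∈ lat (dia (odd fun i => (γ i : ℤ))), toF (m⁻¹).1 *ᵥ w ∈ lat (dia (total θ ζ)) := by
    intro w hw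
    rw [hmF', ← Matrix.mulVec_mulVec, ← hmem2, hmem1, Matrix.mulVec_mulVec, toSp_inv_mul,
      Matrix.one_mulVec]
    exact hw
  have hle := le_of_apply_mem_ord hγ' hγ m.isUnit (toF_apply_mem_ord_of_map_le h1)
  have hge := le_of_apply_mem_ord hγ hγ' (m⁻¹).isUnit (toF_apply_mem_ord_of_map_le h2)
  have heq : γ = fun i => θ.1 i + ζ.1 i := le_antisymm hge hle
  subst heq
  obtain ⟨x, hx, hn, hpt⟩ := exists_eq_pt p (isOdd_total θ ζ) hL
  refine ⟨hp0, k, hk, _, x, hx, hn, fun i => ?_, hpt⟩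
  have h3 : (toSp k⁻¹ : MatF n) *ᵥ p.v = toF m.1 *ᵥ fun i => tpow (-θ.selfDual i) := by
    rw [show p.v = _ from hgv, Matrix.mulVec_mulVec, hmF]
  rw [h3]
  refine mulVec_mem_ord fun j => ?_
  rw [mul_comm, tpow_mul_mem_ord]
  rcases le_total (total θ ζ j) (total θ ζ i) with h | h
  · have := (isContraction_total θ ζ j i h).1
    exact ord_anti (by omega) (coe_mem_ord (m.1 i j))
  · have := (isContraction_total θ ζ i j h).2
    refine ord_anti (m' := total θ ζ j - total θ ζ i) (by omega) ?_
    exact toF_apply_mem_ord_of_map_le h1 i j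

theorem closure_stratum (θ ζ : Partition n) :
    closure (stratum (isOdd_total θ ζ) θ.selfDual) = Lam θ ζ :=
  subset_antisymm (closure_minimal (stratum_subset_closure θ ζ) isClosed_closure)
    (closure_mono (fixedConormal_subset_stratum θ ζ))

/-- Every point of the zero fiber lies in the stratum of a self-dual bisignature. -/
theorem exists_mem_stratum {p : SpCot n} (hp : p ∈ zeroFiber n) :
    ∃ θ ζ : Partition n, p ∈ stratum (isOdd_total θ ζ) θ.selfDual := by
  obtain ⟨k, hk, γ, hγ, hL⟩ := exists_eq_lat_frame p.selfDual p.isLattice.fg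
  obtain ⟨x, hx, hn, hpt⟩ := exists_eq_pt p (isOdd_odd fun i => (γ i : ℤ)) hL
  set c := odd fun i => (γ i : ℤ) with hc
  set v := (toSp k⁻¹ : MatF n) *ᵥ p.v with hv
  have hmom := pt_mem_zeroFiber_iff.1 (hpt ▸ hp)
  have hprod : ∀ i j, v i * v j ∈ ord (-max 0 (c i + c j)) := by
    intro i j
    have h1 : v i * corow v (Sum.swap j) ∈ ord (min 0 (-c j - c i)) := by
      have h2 := (ord (min 1 (1 + c (Sum.swap j) - c i))).sub_mem
        (ord_anti (min_le_left _ _) (hmom i (Sum.swap j)))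
        (ord_anti (min_le_right _ _) (hn i (Sum.swap j)))
      rw [momMat_apply, add_sub_cancel_left, tpow_mul_mem_ord, hc, isOdd_odd, ← hc] at h2
      exact ord_anti (by omega) h2
    refine ord_anti (m' := min 0 (-c j - c i)) (by omega) ?_
    rcases j with j | j
    · exact h1
    · have h2 := (ord _).neg_mem h1
      have h3 : corow v (Sum.swap (Sum.inr j)) = -v (Sum.inr j) := rfl
      rwa [h3, show -(v i * -v (Sum.inr j)) = v i * v (Sum.inr j) by ring] at h2
  set B : ℤ := ∑ i, |(v i).order| with hB
  have hBle : ∀ i, |(v i).order| ≤ B := fun i =>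
    Finset.single_le_sum (f := fun i => |(v i).order|) (fun _ _ => abs_nonneg _)
      (Finset.mem_univ i)
  classical
  set a : Idx n → ℤ := fun i => if v i = 0 then -B else -(v i).order with ha
  have hamem : ∀ i, v i ∈ ord (-a i) := by
    intro i
    by_cases h : v i = 0
    · rw [h]
      exact Submodule.zero_mem _
    · rw [ha]
      simp only [if_neg h, neg_neg]
      exact fun j hj => HahnSeries.coeff_eq_zero_of_lt_order hj
  have hsum : ∀ i j, a i + a j ≤ max 0 (c i + c j) := by
    intro i j
    have hi := hBle i
    have hj := hBle j
    rw [abs_le] at hi hj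
    by_cases h : v i = 0
    · by_cases h' : v j = 0
      · simp only [ha, if_pos h, if_pos h']
        omega
      · simp only [ha, if_pos h, if_neg h']
        omega
    · by_cases h' : v j = 0
      · simp only [ha, if_neg h, if_pos h']
        omega
      · simp only [ha, if_neg h, if_neg h']
        by_contra! hlt
        have h1 := hprod i j ((v i).order + (v j).order) (by omega)
        rw [HahnSeries.coeff_mul_order_add_order] at h1
        rcases mul_eq_zero.1 h1 with h2 | h2
        · exact h (HahnSeries.leadingCoeff_eq_zero.1 h2)
        · exact h' (HahnSeries.leadingCoeff_eq_zero.1 h2)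
  obtain ⟨θ, ζ, hγs, hle⟩ := exists_bisignature hγ hsum
  obtain rfl : γ = fun i => θ.1 i + ζ.1 i := funext hγs
  refine ⟨θ, ζ, hp, k, hk, v, x, hx, hn, fun i => ord_anti ?_ (hamem i), hpt⟩
  have : a i ≤ θ.selfDual i := hle i
  omega

end Conormal

/-! ### Closedness and boundedness -/

section Closed

variable {n : ℕ}

theorem isClosed_zeroFiber : IsClosed (zeroFiber n) := by
  refine isClosed_of_coeff (ι := Idx n × Idx n × Set.Iio (1 : ℤ))
    (fun a f => f (Sum.inr (Sum.inr (a.1, a.2.1))) +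
      tpow 1 * (f (Sum.inl a.1) * corow (fun l => f (Sum.inl l)) a.2.1)) (fun a => a.2.2)
    (fun a N => ?_) fun p => ?_
  · obtain ⟨i, j, m⟩ := a
    have h1 : (fun x : bounded (Crd n) N => corow (fun l => x.1 (Sum.inl l)) j) ∈
        laurentFam (regFun (Crd n) N) := by
      rcases j with j | j
      · exact neg_mem (coord_mem_regFam N (Sum.inl (Sum.inr j)))
      · exact coord_mem_regFam N (Sum.inl (Sum.inl j))
    exact add_mem (coord_mem_regFam N _)
      (mul_mem (laurentFam_const _ _) (mul_mem (coord_mem_regFam N _) h1))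
  · rw [mem_zeroFiber_iff]
    exact ⟨fun h a => h a.1 a.2.1 a.2.2 a.2.2.2, fun h i j m hm => h (i, j, ⟨m, hm⟩)⟩

/-- The points `(v, L, x)` with `v` and `L` contained in `t^{-N} V_𝐎`. -/
def boundedPart (n N : ℕ) : Set (SpCot n) :=
  {p | p.v ∈ bounded (Idx n) N ∧ (p.L : Set (VF n)) ⊆ bounded (Idx n) N}

theorem mem_bounded {κ : Type} {N : ℕ} {f : κ → F} : f ∈ bounded κ N ↔ ∀ i, f i ∈ ord (-N) :=
  Iff.rfl

theorem lat_subset_bounded_iff {g : MatF n} {N : ℕ} :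
    (lat g : Set (VF n)) ⊆ bounded (Idx n) N ↔ ∀ i j, g i j ∈ ord (-N) := by
  constructor
  · intro h i j
    have h1 : g *ᵥ Pi.single j 1 ∈ lat g := by
      refine ⟨Pi.single j 1, mem_stdLattice.2 fun l => ?_, rfl⟩
      by_cases hl : l = j
      · rw [hl, Pi.single_eq_same]
        exact tpow_mem_ord 0
      · rw [Pi.single_eq_of_ne hl]
        exact Submodule.zero_mem _
    have h2 := mem_bounded.1 (h h1) i
    rwa [Matrix.mulVec_single_one] at h2
  · rintro h _ ⟨w, hw, rfl⟩
    refine mem_bounded.2 fun i => mulVec_mem_ord fun j => ?_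
    exact add_zero (-(N : ℤ)) ▸ mul_mem_ord (h i j) (mem_stdLattice.1 hw j)

theorem isClosed_boundedPart (N : ℕ) : IsClosed (boundedPart n N) := by
  refine isClosed_of_coeff (ι := (Idx n ⊕ Idx n × Idx n) × Set.Iio (-N : ℤ))
    (fun a f => f (Sum.elim Sum.inl (fun ij => Sum.inr (Sum.inl ij)) a.1)) (fun a => a.2)
    (fun a N => coord_mem_regFam N _) fun p => ?_
  have h1 : p.1.1 ∈ boundedPart n N ↔ (∀ i, p.1.1.v i ∈ ord (-N)) ∧
      ∀ i j, (p.1.2 : MatF n) i j ∈ ord (-N) := by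
    rw [← lat_subset_bounded_iff, ← p.2]
    rfl
  rw [h1]
  constructor
  · rintro ⟨h2, h3⟩ ⟨i | ⟨i, j⟩, m, hm⟩
    · exact h2 i m hm
    · exact h3 i j m hm
  · exact fun h => ⟨fun i m hm => h (Sum.inl i, ⟨m, hm⟩),
      fun i j m hm => h (Sum.inr (i, j), ⟨m, hm⟩)⟩

theorem isBounded_closure_stratum {c : Idx n → ℤ} (hc : IsOdd c) (lam : Idx n → ℤ) :
    IsBounded (closure (stratum hc lam)) := by
  set N : ℕ := ∑ i, ((c i).natAbs + (lam i).natAbs) with hN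
  have hle : ∀ i, (c i).natAbs + (lam i).natAbs ≤ N := fun i =>
    Finset.single_le_sum (f := fun i => (c i).natAbs + (lam i).natAbs) (fun _ _ => Nat.zero_le _)
      (Finset.mem_univ i)
  refine ⟨N, fun p hp => ?_⟩
  have : stratum hc lam ⊆ boundedPart n N := by
    rintro p ⟨-, k, -, v, x, hx, hn, hv, rfl⟩
    refine ⟨fun i => mulVec_mem_ord fun j => ?_, ?_⟩
    · have := hle j
      exact ord_anti (by omega) (mul_mem_ord (toSp_apply_mem_ord k i j) (hv j))
    · refine lat_subset_bounded_iff.2 fun i j => ?_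
      have := hle j
      rw [frame_coe, dia, Matrix.mul_diagonal]
      exact ord_anti (by omega) (mul_mem_ord (toSp_apply_mem_ord k i j) (tpow_mem_ord _))
  exact closure_minimal this (isClosed_boundedPart N) hp

theorem le_of_mem_stratum_of_bounded {θ ζ : Partition n} {p : SpCot n} {N : ℕ}
    (hp : p ∈ stratum (isOdd_total θ ζ) θ.selfDual)
    (hL : (p.L : Set (VF n)) ⊆ bounded (Idx n) N) (i : Fin n) : θ.1 i + ζ.1 i ≤ N := by
  obtain ⟨-, k, -, v, x, hx, hn, hv, rfl⟩ := hp
  have h1 := lat_subset_bounded_iff.1 hL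
  have h2 : ((toSp k⁻¹ : MatF n) * (frame k (isOdd_total θ ζ) : MatF n)) (Sum.inl i) (Sum.inl i) ∈
      ord (0 + -(N : ℤ)) := mul_apply_mem_ord (toSp_apply_mem_ord _) h1 _ _
  rw [frame_coe, ← Matrix.mul_assoc, toSp_inv_mul, Matrix.one_mul, dia, Matrix.diagonal_apply_eq]
    at h2
  by_contra! hlt
  have h3 := h2 (-total θ ζ (Sum.inl i)) (by
    have : total θ ζ (Sum.inl i) = ((θ.1 i + ζ.1 i : ℕ) : ℤ) := rfl
    omega)
  rw [HahnSeries.coeff_single_same] at h3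
  exact one_ne_zero h3

theorem finite_partitions (N : ℕ) : {θ : Partition n | ∀ i, θ.1 i ≤ N}.Finite :=
  Set.Finite.preimage (f := Subtype.val) Subtype.val_injective.injOn
    (Set.finite_Iic (fun _ : Fin n => N))

end Closed

end MirabolicSp

end

theorem mainTheorem4 (n : ℕ) (Z : Set (MirabolicSp.SpCot n))
    (hZ : MirabolicSp.IsIrreducibleComponent (MirabolicSp.zeroFiber n) Z) :
    ∃ θ ζ : MirabolicSp.Partition n, Z = MirabolicSp.Lam θ ζ := by
  obtain ⟨hZ0, -, hZi, N, hN⟩ := hZ.1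
  set I : Set (MirabolicSp.Partition n × MirabolicSp.Partition n) :=
    {θ | ∀ i, θ.1 i ≤ N} ×ˢ {ζ | ∀ i, ζ.1 i ≤ N} with hI
  have hIfin : I.Finite := (MirabolicSp.finite_partitions N).prod (MirabolicSp.finite_partitions N)
  have hcover : Z ⊆ ⋃₀ ((fun a : MirabolicSp.Partition n × MirabolicSp.Partition n =>
      MirabolicSp.Lam a.1 a.2) '' I) := by
    intro p hp
    obtain ⟨θ, ζ, h⟩ := MirabolicSp.exists_mem_stratum (hZ0 hp)
    have hle := MirabolicSp.le_of_mem_stratum_of_bounded h (hN p hp).2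
    refine ⟨_, ⟨(θ, ζ), ⟨fun i => ?_, fun i => ?_⟩, rfl⟩, ?_⟩
    · exact (Nat.le_add_right _ _).trans (hle i)
    · exact (Nat.le_add_left _ _).trans (hle i)
    · dsimp only
      rw [← MirabolicSp.closure_stratum]
      exact subset_closure h
  have hfin := hIfin.image fun a => MirabolicSp.Lam a.1 a.2
  obtain ⟨W, hW, hZW⟩ := isIrreducible_iff_sUnion_isClosed.1 hZi hfin.toFinset
    (fun W hW => by
      obtain ⟨a, -, rfl⟩ := hfin.mem_toFinset.1 hW
      exact isClosed_closure)
    (by rwa [hfin.coe_toFinset])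
  obtain ⟨⟨θ, ζ⟩, -, rfl⟩ := hfin.mem_toFinset.1 hW
  refine ⟨θ, ζ, subset_antisymm hZW (hZ.2 ⟨?_, isClosed_closure, ⟨hZi.1.mono hZW, ?_⟩, ?_⟩ hZW)⟩
  · rw [← MirabolicSp.closure_stratum]
    exact closure_minimal (fun p hp => hp.1) MirabolicSp.isClosed_zeroFiber
  · rw [← MirabolicSp.closure_stratum]
    exact (MirabolicSp.isPreirreducible_stratum _ (MirabolicSp.isOdd_selfDual θ)
      (MirabolicSp.isContraction_total θ ζ)).closure
  · rw [← MirabolicSp.closure_stratum]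
    exact MirabolicSp.isBounded_closure_stratum _ _
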